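/- Let $X$ be a compact Riemann surface, $L\to X$ a holomorphic line bundle, $n\ge 1$, and let $(E,\Phi,\omega)$ be an $L$-twisted $\mathrm{Sp}_{2n}$-Higgs bundle with $L$-valued symplectic form: $E$ is a holomorphic vector bundle of rank $2n$, $\Phi:E\to L\otimes E$ is a holomorphic homomorphism, $\omega:E\otimes E\to L$ is a holomorphic, fibrewise non-degenerate alternating form, and $\omega(\Phi v,w)+\omega(v,\Phi w)=0$. Let $p(\lambda)=\det(\lambda-\Phi)=\lambda^{2n}+a_2\lambda^{2n-2}+\cdots+a_{2n}$, $a_{2k}\in H^0(X,L^{2k})$ (with $a_0=1$). Assume that the spectral curve $\{p(\lambda)=0\}\subset \mathrm{Tot}(L)$ is smooth (the differential of its defining equation vanishes at no point of it) and that $a_{2n-2}$ and $a_{2n}$ have no common zeros. Let $D\subset X$ be the set of zeros of $a_{2n}$. On $L^{-1}E\oplus L^{-n}$ let $\phi(v,w)=(\Phi v,0)$, and let $Q$ be the symmetric bilinear form obtained by polarisation from $Q((v,w),(v,w))=\omega(v,\Phi v)+w^2a_{2n}$. Hecke data are a family $\{i_x\}_{x\in D}$ of injective linear maps $i_x:L_x^{-n}\to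 L_x^{-1}E_x$. They define a bundle $V$, whose sheaf of sections consists of the meromorphic sections of $L^{-1}E\oplus L^{-n}$ that are holomorphic away from $D$ and have at most simple poles along $D$, with residue at each $x\in D$ in $\Gamma_x=\{(-i_xw,w): w\in L_x^{-n}\}$. One says that $\phi$ (resp. $Q$) extends holomorphically over $D$ if it maps sections of $V$ to sections of $L\otimes V$ (resp. pairs of sections of $V$ to holomorphic functions). For $x\in D$, choose a local coordinate $z$ centred at $x$ and local holomorphic trivialisations of $L$ and $E$ near $x$, and write $\Phi(z)=\Phi_x+z\Phi'_x+O(z^2)$ and $a_{2n}(z)=z\,a_{2n}'(0)+O(z^2)$. Then: 1. For all Hecke data $\{i_x\}$, $\phi$ extends holomorphically over $D$ if and only if $i_x(L_x^{-n})=\ker\Phi_x$ for every $x\in D$ (where $\ker \Phi_x$ is the kernel of $\Phi_x$ on $L_x^{-1}E_x$). 2. For Hecke data with $i_x(L_x^{-n})=\ker\Phi_x$ for every $x\in D$, and for any choice of local coordinates and trivialisations at the points of $D$, $Q$ extends holomorphically over $D$ if and only if, for every $x\in D$, $$\omega_x(i_xw,\Phi'_x\,i_xw)=-w^2a_{2n}'(0)\qquad\text{for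 all } w\in L_x^{-n}.\tag{$*$}$$ 3. There exist Hecke data $\{i_x\}$ such that $i_x(L_x^{-n})=\ker\Phi_x$ and $(*)$ holds, for every $x\in D$ and every choice of local coordinate and trivialisations; for these, both $\phi$ and $Q$ extend holomorphically over $D$. They are unique up to sign: for any choice of local coordinates and trivialisations, Hecke data $\{i'_x\}$ satisfy $i'_x(L_x^{-n})=\ker\Phi_x$ and $(*)$ for every $x\in D$ if and only if, for each $x\in D$, $i'_x=i_x$ or $i'_x=-i_x$. -/

import Mathlib

open Bundle TensorProduct
open scoped Manifold ContDiff Topology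

namespace HeckeHiggs

noncomputable section

set_option linter.unusedSectionVars false

universe u v w

/-! ### Twisted fibres

`L` is a line bundle and `E` a vector bundle over a Riemann surface `X`. -/

section Fibres

variable {X : Type u} (L : X → Type v) [∀ x, AddCommGroup (L x)] [∀ x, Module ℂ (L x)]
  (E : X → Type w) [∀ x, AddCommGroup (E x)] [∀ x, Module ℂ (E x)] (n : ℕ) (x : X)

/-- The fibre at `x` of the dual line bundle `L⁻¹`. -/
abbrev DualFibre : Type v := L x →ₗ[ℂ] ℂ

/-- The fibre at `x` of `L⁻¹ ⊗ E = Hom(L, E)`. -/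
abbrev TwistFibre : Type (max v w) := L x →ₗ[ℂ] E x

/-- The fibre at `x` of `L⁻ⁿ = Hom(L ⊗ ⋯ ⊗ L, ℂ)`. -/
abbrev NegPowFibre : Type v := MultilinearMap ℂ (fun _ : Fin n => L x) ℂ

/-- The fibre at `x` of `L⁻¹E ⊕ L⁻ⁿ`. -/
abbrev SumFibre : Type (max v w) := TwistFibre L E x × NegPowFibre L n x

variable {L E x}

/-- Contraction `L_x ⊗ E_x → E_x` with a covector `ξ ∈ L_x⁻¹`. -/
def contract (ξ : DualFibre L x) : L x ⊗[ℂ] E x →ₗ[ℂ] E x :=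
  (TensorProduct.lid ℂ (E x)).toLinearMap ∘ₗ LinearMap.rTensor (E x) ξ

end Fibres

/-! ### Holomorphic sections -/

section Holomorphic

variable {X : Type u} [TopologicalSpace X] [ChartedSpace ℂ X]

/-- `f` is a holomorphic function on the open set `U`. -/
def HolFun (U : Set X) (f : X → ℂ) : Prop :=
  MDifferentiableOn 𝓘(ℂ, ℂ) 𝓘(ℂ, ℂ) f U

/-- `s` is a holomorphic section over the open set `U` of the vector bundle `E` with model
fibre `F`. -/
def HolSec (F : Type*) [NormedAddCommGroup F] [NormedSpace ℂ F]
    {E : X → Type w} [TopologicalSpace (TotalSpace F E)]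
    [∀ x, AddCommGroup (E x)] [∀ x, Module ℂ (E x)] [∀ x, TopologicalSpace (E x)]
    [FiberBundle F E] (U : Set X) (s : ∀ x, E x) : Prop :=
  MDifferentiableOn 𝓘(ℂ, ℂ) (𝓘(ℂ, ℂ).prod 𝓘(ℂ, F)) (fun x => TotalSpace.mk' F x (s x)) U

variable {L : X → Type v} [TopologicalSpace (TotalSpace ℂ L)]
  [∀ x, AddCommGroup (L x)] [∀ x, Module ℂ (L x)] [∀ x, TopologicalSpace (L x)] [FiberBundle ℂ L]

/-- Holomorphic sections of `L⁻¹` over the open set `U`: they take local holomorphic sections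
of `L` to holomorphic functions. -/
def HolDual (U : Set X) (ξ : ∀ x, DualFibre L x) : Prop :=
  ∀ (W : Set X) (l : ∀ x, L x), IsOpen W → W ⊆ U → HolSec ℂ W l →
    HolFun W (fun x => ξ x (l x))

/-- Holomorphic sections of `L⁻ⁿ` over the open set `U`: evaluation on `ℓ ⊗ ⋯ ⊗ ℓ` is holomorphic
for each local holomorphic section `ℓ` of `L` (as `L` is a line bundle, powers `ℓⁿ` suffice). -/
def HolNegPow {n : ℕ} (U : Set X) (t : ∀ x, NegPowFibre L n x) : Prop :=
  ∀ (W : Set X) (l : ∀ x, L x), IsOpen W → W ⊆ U → HolSec ℂ W l →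
    HolFun W (fun x => t x (fun _ => l x))

/-- Holomorphic sections of `L⁻¹E = Hom(L, E)` over the open set `U`: they take local holomorphic
sections of `L` to holomorphic sections of `E`. -/
def HolTwist (F : Type*) [NormedAddCommGroup F] [NormedSpace ℂ F]
    {E : X → Type w} [TopologicalSpace (TotalSpace F E)]
    [∀ x, AddCommGroup (E x)] [∀ x, Module ℂ (E x)] [∀ x, TopologicalSpace (E x)]
    [FiberBundle F E] (U : Set X) (t : ∀ x, TwistFibre L E x) : Prop :=
  ∀ (W : Set X) (l : ∀ x, L x), IsOpen W → W ⊆ U → HolSec ℂ W l →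
    HolSec F W (fun x => t x (l x))

end Holomorphic

/-! ### Symplectic Higgs bundles -/

/-- The model fibre of a bundle of rank `2n`. -/
abbrev Model (n : ℕ) : Type := Fin (2 * n) → ℂ

section Higgs

variable {X : Type u} [TopologicalSpace X] [ChartedSpace ℂ X]
  (n : ℕ)
  (L : X → Type v) [TopologicalSpace (TotalSpace ℂ L)]
  [∀ x, AddCommGroup (L x)] [∀ x, Module ℂ (L x)] [∀ x, TopologicalSpace (L x)] [FiberBundle ℂ L]
  (E : X → Type w) [TopologicalSpace (TotalSpace (Model n) E)]
  [∀ x, AddCommGroup (E x)] [∀ x, Module ℂ (E x)] [∀ x, TopologicalSpace (E x)]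
  [FiberBundle (Model n) E]

/-- An `L`-twisted `Sp(2n)`-Higgs structure on the rank `2n` bundle `E`, with `L`-valued
symplectic form: a holomorphic homomorphism `Φ : E → L ⊗ E` and a holomorphic, non-degenerate
alternating form `ω : E ⊗ E → L` (the field `form`) with `ω(Φ v, w) + ω(v, Φ w) = 0`.
Identities with values in `L ⊗ ⋯` are stated after contracting `Φ` with each `ξ ∈ L_x⁻¹`. -/
structure SpHiggs where
  Φ : ∀ x, E x →ₗ[ℂ] L x ⊗[ℂ] E x
  form : ∀ x, E x →ₗ[ℂ] E x →ₗ[ℂ] L x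
  hol_Φ : ∀ (U : Set X) (ξ : ∀ x, DualFibre L x) (s : ∀ x, E x), IsOpen U →
    HolDual U ξ → HolSec (Model n) U s → HolSec (Model n) U (fun x => contract (ξ x) (Φ x (s x)))
  hol_form : ∀ (U : Set X) (s t : ∀ x, E x), IsOpen U →
    HolSec (Model n) U s → HolSec (Model n) U t → HolSec ℂ U (fun x => form x (s x) (t x))
  alternating : ∀ x e, form x e e = 0
  nondegenerate : ∀ x e, (∀ e', form x e e' = 0) → e = 0
  compatible : ∀ x (ξ : DualFibre L x) e e',
    form x (contract ξ (Φ x e)) e' + form x e (contract ξ (Φ x e')) = 0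

variable {L E n}

/-- The fibres of a bundle with model fibre `ℂ²ⁿ` are finite-dimensional. -/
theorem finite_fibre [VectorBundle ℂ (Model n) E] (x : X) : Module.Finite ℂ (E x) :=
  Module.Finite.equiv ((trivializationAt (Model n) E x).linearEquivAt ℂ x
    (mem_baseSet_trivializationAt (Model n) E x)).symm

namespace SpHiggs

variable (H : SpHiggs n L E)

/-- The endomorphism of `E_x` obtained by contracting `Φ_x` with `ξ ∈ L_x⁻¹`. If `ξ ≠ 0` and
`ℓ ∈ L_x` has `ξ(ℓ) = 1`, then `Φ_x = ℓ ⊗ (H.endo x ξ)`. -/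
def endo (x : X) (ξ : DualFibre L x) : E x →ₗ[ℂ] E x := contract ξ ∘ₗ H.Φ x

/-- The characteristic polynomial of `Φ_x`, written with respect to `ξ ∈ L_x⁻¹`. -/
def charPoly [VectorBundle ℂ (Model n) E] (x : X) (ξ : DualFibre L x) : Polynomial ℂ :=
  haveI := finite_fibre (n := n) (E := E) x
  LinearMap.charpoly (H.endo x ξ)

/-- The characteristic coefficient `a_k(x) ∈ L_x^k`, for `k ≤ 2n`, in
`p(λ) = λ²ⁿ + a₁ λ²ⁿ⁻¹ + ⋯ + a₂ₙ`. An element of `L_x^k` is viewed as a function of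
`ξ ∈ L_x⁻¹`, homogeneous of degree `k`. -/
def charCoeff [VectorBundle ℂ (Model n) E] (k : ℕ) (x : X) (ξ : DualFibre L x) : ℂ :=
  (H.charPoly x ξ).coeff (2 * n - k)

/-- The zero set of the section `a_k` of `L^k`. -/
def zeros [VectorBundle ℂ (Model n) E] (k : ℕ) : Set X :=
  {x | ∀ ξ : DualFibre L x, H.charCoeff k x ξ = 0}

/-- The set `D` of zeros of `a₂ₙ = det Φ`. -/
abbrev D [VectorBundle ℂ (Model n) E] : Set X := H.zeros (2 * n)

end SpHiggs

end Higgs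

/-! ### Local coordinates and trivialisations -/

section Local

variable {X : Type u} [TopologicalSpace X] [ChartedSpace ℂ X]
  (n : ℕ)
  (L : X → Type v) [TopologicalSpace (TotalSpace ℂ L)]
  [∀ x, AddCommGroup (L x)] [∀ x, Module ℂ (L x)] [∀ x, TopologicalSpace (L x)] [FiberBundle ℂ L]
  (E : X → Type w) [TopologicalSpace (TotalSpace (Model n) E)]
  [∀ x, AddCommGroup (E x)] [∀ x, Module ℂ (E x)] [∀ x, TopologicalSpace (E x)]
  [FiberBundle (Model n) E]

/-- Local data at `x`: a holomorphic chart of `X` around `x`, and local trivialisations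
of `L` and of `E` around `x`. The local coordinate centred at `x` is `z = chart - chart x`. -/
structure LocalData (x : X) where
  chart : OpenPartialHomeomorph X ℂ
  chart_mem : chart ∈ IsManifold.maximalAtlas 𝓘(ℂ, ℂ) ω X
  mem_source : x ∈ chart.source
  trivL : Trivialization ℂ (π ℂ L)
  trivL_mem : MemTrivializationAtlas trivL
  mem_trivL : x ∈ trivL.baseSet
  trivE : Trivialization (Model n) (π (Model n) E)
  trivE_mem : MemTrivializationAtlas trivE
  mem_trivE : x ∈ trivE.baseSet

attribute [instance] LocalData.trivL_mem LocalData.trivE_mem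

variable {n L E} [VectorBundle ℂ ℂ L] [VectorBundle ℂ (Model n) E]

namespace LocalData

variable {x : X} (d : LocalData n L E x)

/-- The frame `ℓ` of `L` given by the trivialisation. -/
def frame (y : X) : L y := d.trivL.symmₗ ℂ y 1

/-- The dual frame `ℓ⁻¹` of `L⁻¹`. -/
def coframe (y : X) : DualFibre L y := d.trivL.linearMapAt ℂ y

/-- In the local data, `Φ(z) = ℓ ⊗ (matrix of holomorphic functions)`: this is the matrix, as an
endomorphism of the model fibre, at the point with chart value `z`. -/
def higgs (H : SpHiggs n L E) (z : ℂ) : Model n →ₗ[ℂ] Model n :=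
  d.trivE.linearMapAt ℂ (d.chart.symm z) ∘ₗ
    H.endo (d.chart.symm z) (d.coframe (d.chart.symm z)) ∘ₗ d.trivE.symmₗ ℂ (d.chart.symm z)

/-- The first-order coefficient `Φ'_x` in `Φ(z) = Φ_x + z Φ'_x + ⋯`, applied to `e ∈ E_x`. -/
def higgsDeriv (H : SpHiggs n L E) (e : E x) : E x :=
  d.trivE.symmₗ ℂ x
    (deriv (fun z => d.higgs H z (d.trivE.linearMapAt ℂ x e)) (d.chart x))

/-- The function `a_k(z)`: the section `a_k` of `L^k` in the frame `ℓ^k`. -/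
def coeffFun (H : SpHiggs n L E) (k : ℕ) (z : ℂ) : ℂ :=
  H.charCoeff k (d.chart.symm z) (d.coframe (d.chart.symm z))

end LocalData

/-- The spectral curve `S ⊂ Tot(L)`, the zero locus of `p(λ) = det(λ - Φ)`, is smooth: in the
coordinates `(λ, z) ↦ λ ℓ(z)` on `Tot(L)`, the differential of the defining equation
does not vanish at any point of the curve. -/
def SpHiggs.SpectralCurveSmooth (H : SpHiggs n L E) : Prop :=
  ∀ (x : X) (d : LocalData n L E x) (lam : ℂ),
    (H.charPoly x (d.coframe x)).eval lam = 0 →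
    fderiv ℂ (fun q : ℂ × ℂ =>
      (H.charPoly (d.chart.symm q.2) (d.coframe (d.chart.symm q.2))).eval q.1)
      (lam, d.chart x) ≠ 0

end Local

/-! ### The Hecke modification -/

section Hecke

variable {X : Type u} [TopologicalSpace X] [ChartedSpace ℂ X]
  {n : ℕ}
  {L : X → Type v} [TopologicalSpace (TotalSpace ℂ L)]
  [∀ x, AddCommGroup (L x)] [∀ x, Module ℂ (L x)] [∀ x, TopologicalSpace (L x)] [FiberBundle ℂ L]
  {E : X → Type w} [TopologicalSpace (TotalSpace (Model n) E)]
  [∀ x, AddCommGroup (E x)] [∀ x, Module ℂ (E x)] [∀ x, TopologicalSpace (E x)]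
  [FiberBundle (Model n) E]
  [VectorBundle ℂ ℂ L] [VectorBundle ℂ (Model n) E]

namespace SpHiggs

variable (H : SpHiggs n L E)

/-- The kernel of `Φ_x` in `L_x⁻¹E_x`. -/
def twistKer (x : X) : Submodule ℂ (TwistFibre L E x) where
  carrier := {t | H.Φ x ∘ₗ t = 0}
  zero_mem' := LinearMap.comp_zero _
  add_mem' := fun {a b} ha hb => by
    change H.Φ x ∘ₗ a = 0 at ha
    change H.Φ x ∘ₗ b = 0 at hb
    change H.Φ x ∘ₗ (a + b) = 0
    rw [LinearMap.comp_add, ha, hb, add_zero]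
  smul_mem' := fun c a ha => by
    change H.Φ x ∘ₗ a = 0 at ha
    change H.Φ x ∘ₗ (c • a) = 0
    rw [LinearMap.comp_smul, ha, smul_zero]

/-- The Higgs field `φ(t, w) = (Φ t, 0)` on `L⁻¹E ⊕ L⁻ⁿ`, contracted with `ξ ∈ L_x⁻¹`. -/
def phi (x : X) (ξ : DualFibre L x) (s : SumFibre L E n x) : SumFibre L E n x :=
  (H.endo x ξ ∘ₗ s.1, 0)

/-- The value `ω(t, Φ t) + w² a₂ₙ`, computed with `ξ ∈ L_x⁻¹` and `ℓ ∈ L_x` such that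
`ξ(ℓ) = 1`. -/
def quadWith (x : X) (ξ : DualFibre L x) (l : L x) (s : SumFibre L E n x) : ℂ :=
  ξ (H.form x (s.1 l) (H.endo x ξ (s.1 l))) + (s.2 fun _ => l) ^ 2 * H.charCoeff (2 * n) x ξ

/-- The quadratic form `Q((t, w), (t, w)) = ω(t, Φ t) + w² a₂ₙ` on `L_x⁻¹E_x ⊕ L_x⁻ⁿ`, computed in
the preferred trivialisation of `L` at `x`; see `quad_eq` for the independence. -/
def quad (x : X) (s : SumFibre L E n x) : ℂ :=
  H.quadWith x ((trivializationAt ℂ L x).linearMapAt ℂ x)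
    ((trivializationAt ℂ L x).symmₗ ℂ x 1) s

/-- The symmetric bilinear form `Q`, given by the polarisation identity. -/
def Q (x : X) (s t : SumFibre L E n x) : ℂ :=
  (H.quad x (s + t) - H.quad x s - H.quad x t) / 2

end SpHiggs

/-- The coordinate centred at `x` given by the preferred chart of `X` at `x`. -/
def localCoord (x y : X) : ℂ := chartAt ℂ x y - chartAt ℂ x x

/-- Hecke data: an injective homomorphism `i_x : L_x⁻ⁿ → L_x⁻¹E_x` for each `x ∈ D`. -/
structure HeckeData (H : SpHiggs n L E) where
  map : ∀ x : H.D, NegPowFibre L n x.1 →ₗ[ℂ] TwistFibre L E x.1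
  injective : ∀ x, Function.Injective (map x)

namespace HeckeData

variable {H : SpHiggs n L E} (i : HeckeData H)

/-- `i_x(L_x⁻ⁿ) = ker Φ_x` for each `x ∈ D`. -/
def RangeEqKer : Prop := ∀ x : H.D, LinearMap.range (i.map x) = H.twistKer x.1

/-- The condition `ω_x(i_x w, Φ'_x i_x w) = - w² a₂ₙ'(0)` for all `w ∈ L_x⁻ⁿ`, where `Φ'_x` and
`a₂ₙ'(0)` are computed in the local data `d` at `x ∈ D`. -/
def ScaleCondition (x : H.D) (d : LocalData n L E x.1) : Prop :=
  ∀ w : NegPowFibre L n x.1,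
    d.coframe x.1 (H.form x.1 (i.map x w (d.frame x.1))
        (d.higgsDeriv H (i.map x w (d.frame x.1)))) =
      - (w fun _ => d.frame x.1) ^ 2 * deriv (d.coeffFun H (2 * n)) (d.chart x.1)

/-- `s` has at most a simple pole at `x ∈ D`, with residue in
`Γ_x = {(-i_x w, w) | w ∈ L_x⁻ⁿ}`: near `x`, `z s` extends to a holomorphic section whose value
at `x` lies in `Γ_x`. As `Γ_x` is a linear subspace, the choice of coordinate is immaterial. -/
def PoleAt (x : H.D) (s : ∀ y, SumFibre L E n y) : Prop :=
  ∃ (W : Set X) (s₀ : ∀ y, SumFibre L E n y), IsOpen W ∧ x.1 ∈ W ∧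
    HolTwist (Model n) W (fun y => (s₀ y).1) ∧ HolNegPow W (fun y => (s₀ y).2) ∧
    (∀ y ∈ W, y ≠ x.1 → localCoord x.1 y • s y = s₀ y) ∧
    ∃ w : NegPowFibre L n x.1, s₀ x.1 = (- i.map x w, w)

/-- The sections over the open set `U` of the Hecke-modified bundle `V`: sections of
`L⁻¹E ⊕ L⁻ⁿ` which are holomorphic on `U \ D` and have at most simple poles
along `D`, with residues in the `Γ_x`. The values of `s` on `D` are irrelevant. -/
def IsSection (U : Set X) (s : ∀ y, SumFibre L E n y) : Prop :=
  HolTwist (Model n) (U \ H.D) (fun y => (s y).1) ∧ HolNegPow (U \ H.D) (fun y => (s y).2) ∧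
    ∀ x : H.D, x.1 ∈ U → i.PoleAt x s

/-- `φ` extends to a holomorphic homomorphism `V → L ⊗ V`, that is, `φ` contracted with any local
holomorphic section of `L⁻¹` maps local sections of `V` to local sections of `V`. -/
def PhiExtends : Prop :=
  ∀ (U : Set X) (ξ : ∀ y, DualFibre L y) (s : ∀ y, SumFibre L E n y), IsOpen U →
    HolDual U ξ → i.IsSection U s → i.IsSection U (fun y => H.phi y (ξ y) (s y))

/-- `Q` extends to a holomorphic form `V ⊗ V → 𝓞`: for local sections `s, t` of `V`, the function
`Q(s, t)` extends holomorphically over `D`. -/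
def QExtends : Prop :=
  ∀ (U : Set X) (s t : ∀ y, SumFibre L E n y), IsOpen U → i.IsSection U s → i.IsSection U t →
    ∃ f : X → ℂ, HolFun U f ∧ ∀ y ∈ U \ H.D, f y = H.Q y (s y) (t y)

end HeckeData

/-- The determinant section `a₂ₙ` is homogeneous of degree `2n` on `L_x⁻¹`. -/
theorem SpHiggs.charCoeff_smul (H : SpHiggs n L E) (x : X) (ξ : DualFibre L x) (k : ℂ) :
    H.charCoeff (2 * n) x (k • ξ) = k ^ (2 * n) * H.charCoeff (2 * n) x ξ := by
  have := finite_fibre (n := n) (E := E) x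
  have hr : Module.finrank ℂ (E x) = 2 * n := by
    rw [((trivializationAt (Model n) E x).linearEquivAt ℂ x
      (mem_baseSet_trivializationAt (Model n) E x)).finrank_eq]
    simp [Model]
  have he : H.endo x (k • ξ) = k • H.endo x ξ := by
    ext e
    simp [SpHiggs.endo, contract, LinearMap.rTensor_smul]
  have hd : ∀ η : DualFibre L x, H.charCoeff (2 * n) x η = LinearMap.det (H.endo x η) := by
    intro η
    rw [LinearMap.det_eq_sign_charpoly_coeff, hr]
    simp [SpHiggs.charCoeff, SpHiggs.charPoly]
  rw [hd, hd, he, LinearMap.det_smul, hr]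

/-- The value of `quadWith` does not depend on the dual pair `(ξ, ℓ)`. -/
theorem SpHiggs.quad_eq (H : SpHiggs n L E) (x : X) (ξ : DualFibre L x) (l : L x) (h : ξ l = 1)
    (s : SumFibre L E n x) : H.quad x s = H.quadWith x ξ l s := by
  have hx := mem_baseSet_trivializationAt ℂ L x
  unfold SpHiggs.quad
  set ξ₀ : DualFibre L x := (trivializationAt ℂ L x).linearMapAt ℂ x with hξ₀
  set l₀ : L x := (trivializationAt ℂ L x).symmₗ ℂ x 1 with hl₀
  have hm : ∀ m : L x, m = ξ₀ m • l₀ := by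
    intro m
    rw [hl₀, ← map_smul, smul_eq_mul, mul_one]
    exact ((trivializationAt ℂ L x).symmₗ_linearMapAt hx m).symm
  obtain ⟨c, hc⟩ : ∃ c : ℂ, l = c • l₀ := ⟨ξ₀ l, hm l⟩
  obtain ⟨k, hk⟩ : ∃ k : ℂ, ξ = k • ξ₀ := by
    refine ⟨ξ l₀, LinearMap.ext fun m => ?_⟩
    conv_lhs => rw [hm m]
    simp [mul_comm]
  have h0 : ξ₀ l₀ = 1 := (trivializationAt ℂ L x).linearMapAt_symmₗ hx 1
  have hkc : k * c = 1 := by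
    rw [hk, hc] at h
    simpa [h0, mul_comm] using h
  have he : ∀ e, H.endo x (k • ξ₀) e = k • H.endo x ξ₀ e := by
    intro e
    simp [SpHiggs.endo, contract, LinearMap.rTensor_smul]
  have hs : (s.2 fun _ => c • l₀) = c ^ n * s.2 fun _ => l₀ := by
    have := s.2.map_smul_univ (fun _ => c) (fun _ => l₀)
    simpa using this
  have h1 : k ^ (2 * n) * (c ^ n) ^ 2 = 1 := by
    rw [← pow_mul, mul_comm n 2, ← mul_pow, hkc, one_pow]
  rw [hk, hc]
  unfold SpHiggs.quadWith
  rw [H.charCoeff_smul, hs]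
  simp only [map_smul, he, LinearMap.smul_apply, smul_eq_mul]
  linear_combination (-(k * c + 1) * ξ₀ (H.form x (s.1 l₀) (H.endo x ξ₀ (s.1 l₀)))) * hkc
    - ((s.2 fun _ => l₀) ^ 2 * H.charCoeff (2 * n) x ξ₀) * h1

/-- Local data exist at every point. -/
theorem LocalData.nonempty [IsManifold 𝓘(ℂ, ℂ) ω X] (x : X) : Nonempty (LocalData n L E x) :=
  ⟨{ chart := chartAt ℂ x
     chart_mem := IsManifold.chart_mem_maximalAtlas x
     mem_source := mem_chart_source ℂ x
     trivL := trivializationAt ℂ L x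
     trivL_mem := inferInstance
     mem_trivL := mem_baseSet_trivializationAt ℂ L x
     trivE := trivializationAt (Model n) E x
     trivE_mem := inferInstance
     mem_trivE := mem_baseSet_trivializationAt (Model n) E x }⟩

end Hecke

end

end HeckeHiggs

/-! The problem is local at the points of `D`, and everything rests on `a₂ₙ = det Φ` having simple
zeros there. Skewness of `Φ` for `ω` makes the characteristic polynomial even, so its coefficient of
`λ` vanishes. At the point `λ = 0` over `x ∈ D` the `λ`-derivative of `p` is therefore zero, and
smoothness of the spectral curve forces `a₂ₙ'(0) ≠ 0` (`SpHiggs.deriv_coeffFun_ne_zero`).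

A simple zero of `det A(z)` has two consequences. If `v ≠ 0` and `A(z₀)v = 0`, then `A(z)v = (z -
z₀)B(z)`; putting `B` in place of a column with `v k ≠ 0` divides `det A` by `z - z₀` up to a
non-zero constant, so the new matrix is invertible at `z₀` (`exists_det_updateCol_ne_zero`). Hence
the kernel is a line, and the image of `A(z₀)` together with `A'(z₀)v` spans. By skewness `ω(e, ·)`
kills the image of `Φ_x` when `e` generates `ker Φ_x`, so non-degeneracy gives `ω(e, Φ'_x e) ≠ 0`
(`SpHiggs.form_higgsDeriv_ne_zero`).

For the first claim, write a section of `V` as `s = s₀ / z` with `s₀(x) = (-i_x w, w)`. Then `z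
φ(s)` has value `(-Φ_x i_x w, 0)` at `x`. Its second component is zero, so by linearity of `i_x` it
lies in `Γ_x` only if `Φ_x i_x w = 0`. Since the kernel is a line and `i_x` is injective, this
inclusion is already an equality.

For the second, `Q(s, s) = z⁻² Q(s₀, s₀)`. When the image of `i_x` is the kernel, `Q(s₀, s₀)`
vanishes at `x`, and skewness removes the derivative of `s₀` from its linear coefficient, which is
`ω(i_x w, Φ'_x i_x w) + w² a₂ₙ'(0)`. The vanishing of this number is the only obstruction;
polarisation passes from diagonal values to `Q`.

For the third, `(*)` on the two lines involved is one equation `c² ω(e, Φ'_x e) = -a₂ₙ'(0)` with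
both constants non-zero, so it has exactly two solutions `±c`. Extension of `Q` mentions no
coordinates, so by the second claim `(*)` for one choice of local data implies it for all. -/

namespace HeckeHiggs

noncomputable section

set_option linter.unusedSectionVars false

universe u v w

/-! ### Linear algebra and one complex variable -/

/-- The linear coefficient of the characteristic polynomial of an endomorphism which is
skew for a non-degenerate form vanishes in even rank. -/
theorem charpoly_coeff_one_eq_zero {V : Type*} [AddCommGroup V] [Module ℂ V] [Module.Finite ℂ V]
    {m : ℕ} (hm : Module.finrank ℂ V = 2 * m) (B : V →ₗ[ℂ] V →ₗ[ℂ] ℂ)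
    (hB : ∀ v, (∀ w, B v w = 0) → v = 0) (A : V →ₗ[ℂ] V)
    (hA : ∀ v w, B (A v) w + B v (A w) = 0) : A.charpoly.coeff 1 = 0 := by
  have hinj : Function.Injective B := by
    rw [← LinearMap.ker_eq_bot, LinearMap.ker_eq_bot']
    exact fun v hv => hB v fun w => by rw [hv]; rfl
  let b : V ≃ₗ[ℂ] Module.Dual ℂ V :=
    LinearEquiv.ofInjectiveOfFinrankEq B hinj Subspace.dual_finrank_eq.symm
  have hb : ∀ v w, b v w = B v w := fun v w => rfl
  -- Through `B`, the transpose of `μ - A` is conjugate to `μ + A = -(-μ - A)`; the sign disappears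
  -- from the determinant because the rank is even.
  have hodd : A.charpoly = A.charpoly.comp (-Polynomial.X) := by
    refine Polynomial.funext fun μ => ?_
    rw [Polynomial.eval_comp, Polynomial.eval_neg, Polynomial.eval_X, LinearMap.eval_charpoly,
      LinearMap.eval_charpoly]
    have h1 : (algebraMap ℂ (Module.End ℂ V) μ - A).dualMap =
        (b : V →ₗ[ℂ] Module.Dual ℂ V) ∘ₗ (algebraMap ℂ (Module.End ℂ V) μ + A) ∘ₗ
          (b.symm : Module.Dual ℂ V →ₗ[ℂ] V) := by
      refine LinearMap.ext fun f => ?_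
      obtain ⟨v, rfl⟩ := b.surjective f
      refine LinearMap.ext fun w => ?_
      have := hA v w
      simp [hb, Module.algebraMap_end_apply, LinearMap.dualMap_apply]
      linear_combination -this
    have h2 : algebraMap ℂ (Module.End ℂ V) (-μ) - A =
        (-1 : ℂ) • (algebraMap ℂ (Module.End ℂ V) μ + A) := by
      rw [map_neg, neg_one_smul, neg_add, sub_eq_add_neg]
    rw [← LinearMap.det_dualMap, h1, LinearMap.det_conj, h2, LinearMap.det_smul, hm, pow_mul]
    simp
  -- The derivative of an even polynomial at `0` equals its own negative.
  have h := congrArg (fun p => (Polynomial.derivative p).eval 0) hodd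
  have hc : (Polynomial.derivative A.charpoly).eval 0 = A.charpoly.coeff 1 := by
    rw [← Polynomial.coeff_zero_eq_eval_zero, Polynomial.coeff_derivative]
    simp
  simp only [Polynomial.derivative_comp, Polynomial.eval_mul, Polynomial.eval_comp,
    Polynomial.derivative_neg, Polynomial.derivative_X, Polynomial.eval_neg, Polynomial.eval_X,
    Polynomial.eval_one, neg_zero, hc] at h
  have h3 : (2 : ℂ) * A.charpoly.coeff 1 = 0 := by linear_combination h
  simpa using h3

/-! ### Simple zeros of the determinant of a family of matrices -/

section Det

variable {ι : Type*} [Fintype ι] [DecidableEq ι] {A : ℂ → (ι → ℂ) →ₗ[ℂ] (ι → ℂ)} {z₀ : ℂ}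

theorem differentiableAt_det (hA : ∀ v, DifferentiableAt ℂ (fun z => A z v) z₀) :
    DifferentiableAt ℂ (fun z => LinearMap.det (A z)) z₀ := by
  have h : ∀ i j, DifferentiableAt ℂ (fun z => LinearMap.toMatrix' (A z) i j) z₀ := by
    intro i j
    simp only [LinearMap.toMatrix'_apply]
    exact differentiableAt_pi.1 (hA _) i
  simp only [← LinearMap.det_toMatrix', Matrix.det_apply]
  refine DifferentiableAt.fun_sum fun σ _ => DifferentiableAt.const_smul ?_ _
  exact DifferentiableAt.fun_finsetProd fun i _ => h _ _

/-- If `v` spans part of the kernel of `A(z₀)`, and `det A` has a simple zero at `z₀`, then a matrix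
whose columns are columns of `A(z₀)`, except for one which is `(Av)'(z₀)`, is invertible. -/
theorem exists_det_updateCol_ne_zero (hA : ∀ v, DifferentiableAt ℂ (fun z => A z v) z₀)
    (hd : deriv (fun z => LinearMap.det (A z)) z₀ ≠ 0) {v : ι → ℂ} (hv : v ≠ 0)
    (hker : A z₀ v = 0) :
    ∃ k, v k ≠ 0 ∧ ((LinearMap.toMatrix' (A z₀)).updateCol k
      (deriv (fun z => A z v) z₀)).det ≠ 0 := by
  obtain ⟨k, hk⟩ := Function.ne_iff.1 hv
  refine ⟨k, hk, fun h0 => hd ?_⟩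
  -- `B` is `A(z)v / (z - z₀)`, filled in by the derivative at `z₀`; only its continuity there is
  -- needed.
  set B : ℂ → ι → ℂ := dslope (fun z => A z v) z₀ with hBdef
  have hB : ContinuousAt B z₀ := continuousAt_dslope_same.2 (hA v)
  set N : ℂ → Matrix ι ι ℂ := fun z => (LinearMap.toMatrix' (A z)).updateCol k (B z) with hN
  have hNe : ∀ i j, ContinuousAt (fun z => N z i j) z₀ := by
    intro i j
    by_cases hj : j = k
    · subst hj
      simpa only [hN, Matrix.updateCol_self] using continuousAt_pi.1 hB i
    · simp only [hN, Matrix.updateCol_ne hj, LinearMap.toMatrix'_apply]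
      exact (differentiableAt_pi.1 (hA _) i).continuousAt
  have hNc : ContinuousAt (fun z => (N z).det) z₀ :=
    (Continuous.matrix_det continuous_id).continuousAt.comp
      (continuousAt_pi.2 fun i => continuousAt_pi.2 fun j => hNe i j)
  -- Replacing column `k` by the combination `A(z)v = (z - z₀)B(z)` of all columns multiplies the
  -- determinant by `v k`.
  have hdet : ∀ z, LinearMap.det (A z) = (z - z₀) * ((v k)⁻¹ * (N z).det) := by
    intro z
    have h1 : (fun i => ∑ j, v j • (LinearMap.toMatrix' (A z)) i j) = (z - z₀) • B z := by
      rw [hBdef, sub_smul_dslope, hker, sub_zero]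
      funext i
      conv_rhs => rw [← LinearMap.toMatrix'_mulVec (A z) v]
      simp [Matrix.mulVec, dotProduct, mul_comm]
    have h2 := Matrix.det_updateCol_sum (LinearMap.toMatrix' (A z)) k v
    rw [h1, Matrix.det_updateCol_smul, LinearMap.det_toMatrix', smul_eq_mul] at h2
    have hk' : v k ≠ 0 := hk
    field_simp
    linear_combination -h2
  have hN0 : (N z₀).det = 0 := by
    rw [hN]; simpa only [hBdef, dslope_same] using h0
  have hder : HasDerivAt (fun z => LinearMap.det (A z)) ((v k)⁻¹ * (N z₀).det) z₀ := by
    rw [hasDerivAt_iff_tendsto_slope]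
    have h3 : Filter.Tendsto (fun z => (v k)⁻¹ * (N z).det) (𝓝[≠] z₀)
        (𝓝 ((v k)⁻¹ * (N z₀).det)) := (tendsto_const_nhds.mul hNc).mono_left nhdsWithin_le_nhds
    refine h3.congr' ?_
    filter_upwards [self_mem_nhdsWithin] with z hz
    have hz' : z - z₀ ≠ 0 := sub_ne_zero.2 hz
    rw [slope_def_field, hdet z, hdet z₀]
    field_simp
    ring
  rw [hder.deriv, hN0, mul_zero]

/-- Separates the new column from the old ones: a vector with zero `k`-th entry sees only `M`, and
any vector is sent into the image of `M` plus the line of `b`. -/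
theorem mulVec_updateCol (M : Matrix ι ι ℂ) (k : ι) (b u : ι → ℂ) :
    (M.updateCol k b).mulVec u = M.mulVec (u - Pi.single k (u k)) + u k • b := by
  funext i
  simp only [Matrix.mulVec, dotProduct, Pi.add_apply, Pi.smul_apply, smul_eq_mul, Pi.sub_apply]
  rw [← Finset.add_sum_erase _ _ (Finset.mem_univ k),
    ← Finset.add_sum_erase Finset.univ (fun j => M i j * _) (Finset.mem_univ k)]
  have : ∑ j ∈ Finset.univ.erase k, M.updateCol k b i j * u j =
      ∑ j ∈ Finset.univ.erase k, M i j * (u j - (Pi.single k (u k) : ι → ℂ) j) := by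
    refine Finset.sum_congr rfl fun j hj => ?_
    have hj' := Finset.ne_of_mem_erase hj
    rw [Matrix.updateCol_ne hj', Pi.single_eq_of_ne hj', sub_zero]
  rw [this]
  simp
  ring

/-- A simple zero of `det A` has a kernel of dimension one. -/
theorem ker_eq_span_of_deriv_det_ne_zero (hA : ∀ v, DifferentiableAt ℂ (fun z => A z v) z₀)
    (hd : deriv (fun z => LinearMap.det (A z)) z₀ ≠ 0) {v : ι → ℂ} (hv : v ≠ 0)
    (hker : A z₀ v = 0) {u : ι → ℂ} (hu : A z₀ u = 0) : ∃ c : ℂ, u = c • v := by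
  obtain ⟨k, hk, hdet⟩ := exists_det_updateCol_ne_zero hA hd hv hker
  -- This scalar makes the `k`-th entry of `u - c • v` vanish, so the invertible matrix with
  -- replaced column acts on it as `A z₀`, hence by zero.
  refine ⟨u k / v k, ?_⟩
  rw [← sub_eq_zero]
  refine Matrix.eq_zero_of_mulVec_eq_zero hdet ?_
  have h0 : (u - (u k / v k) • v) k = 0 := by simp [hk]
  rw [mulVec_updateCol, h0]
  simp only [Pi.single_zero, sub_zero, zero_smul, add_zero, LinearMap.toMatrix'_mulVec, map_sub,
    map_smul, hu, hker, smul_zero]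

/-- At a simple zero of `det A`, the image of `A` together with `A'v` spans. -/
theorem eq_zero_of_deriv_det_ne_zero (hA : ∀ v, DifferentiableAt ℂ (fun z => A z v) z₀)
    (hd : deriv (fun z => LinearMap.det (A z)) z₀ ≠ 0) {v : ι → ℂ} (hv : v ≠ 0)
    (hker : A z₀ v = 0) (ψ : (ι → ℂ) →ₗ[ℂ] ℂ) (hψ : ∀ u, ψ (A z₀ u) = 0)
    (hψ' : ψ (deriv (fun z => A z v) z₀) = 0) : ψ = 0 := by
  obtain ⟨k, -, hdet⟩ := exists_det_updateCol_ne_zero hA hd hv hker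
  refine LinearMap.ext fun u => ?_
  obtain ⟨t, rfl⟩ := (Matrix.mulVec_surjective_iff_isUnit.2
    ((Matrix.isUnit_iff_isUnit_det _).2 hdet.isUnit)) u
  rw [mulVec_updateCol, map_add, map_smul, hψ', LinearMap.toMatrix'_mulVec, hψ]
  simp

end Det

/-- Derivative of `A(z) a(z)`, for a family of linear maps which is differentiable on each vector. -/
theorem hasDerivAt_linearMap_apply {ι : Type*} [Fintype ι] {M : Type*} [NormedAddCommGroup M]
    [NormedSpace ℂ M] {A : ℂ → (ι → ℂ) →ₗ[ℂ] M} {z₀ : ℂ}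
    (hA : ∀ v, DifferentiableAt ℂ (fun z => A z v) z₀) {a : ℂ → ι → ℂ} {a' : ι → ℂ}
    (ha : HasDerivAt a a' z₀) :
    HasDerivAt (fun z => A z (a z)) (A z₀ a' + deriv (fun z => A z (a z₀)) z₀) z₀ := by
  classical
  have hsum : ∀ z (u : ι → ℂ), A z u = ∑ k, u k • A z (Pi.single k 1) := by
    intro z u
    conv_lhs => rw [pi_eq_sum_univ' u, map_sum]
    exact Finset.sum_congr rfl fun k _ => map_smul _ _ _
  -- The coordinates of `a z - a z₀` vanish at `z₀`, so the derivative of `A` does not contribute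
  -- here; it enters only through the remaining summand `A z (a z₀)`.
  have h1 : HasDerivAt (fun z => A z (a z - a z₀)) (A z₀ a') z₀ := by
    have h2 : ∀ k, HasDerivAt (fun z => (a z k - a z₀ k) • A z (Pi.single k 1))
        (a' k • A z₀ (Pi.single k 1)) z₀ := by
      intro k
      have h3 := ((hasDerivAt_pi.1 ha k).sub_const (a z₀ k)).fun_smul
        (hA (Pi.single k 1)).hasDerivAt
      simpa using h3
    have h4 := HasDerivAt.fun_sum fun k (_ : k ∈ Finset.univ) => h2 k
    rw [← hsum] at h4
    refine h4.congr_of_eventuallyEq (Filter.Eventually.of_forall fun z => ?_)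
    simpa using hsum z (a z - a z₀)
  refine (h1.add (hA (a z₀)).hasDerivAt).congr_of_eventuallyEq
    (Filter.Eventually.of_forall fun z => ?_)
  simp

/-- A holomorphic function with a zero of order at least two is divisible by the square of the
coordinate. -/
theorem exists_eq_sq_mul {U : Set ℂ} {c : ℂ} (hU : U ∈ 𝓝 c) {g : ℂ → ℂ}
    (hg : DifferentiableOn ℂ g U) (h0 : g c = 0) (h1 : deriv g c = 0) :
    ∃ h : ℂ → ℂ, DifferentiableOn ℂ h U ∧ ∀ z, g z = (z - c) ^ 2 * h z := by
  refine ⟨dslope (dslope g c) c, (Complex.differentiableOn_dslope hU).2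
    ((Complex.differentiableOn_dslope hU).2 hg), fun z => ?_⟩
  have h2 := sub_smul_dslope_of_zero (f := dslope g c) (a := c) (by rw [dslope_same, h1]) z
  have h3 := sub_smul_dslope_of_zero h0 z
  rw [smul_eq_mul] at h2 h3
  rw [← h3, ← h2]
  ring

/-! ### Holomorphic sections in trivialisations -/

section Charts

variable {X : Type*} [TopologicalSpace X] [ChartedSpace ℂ X]
  {F : Type*} [NormedAddCommGroup F] [NormedSpace ℂ F]
  {c : OpenPartialHomeomorph X ℂ}

theorem mdifferentiableAt_chart (hc : c ∈ IsManifold.maximalAtlas 𝓘(ℂ, ℂ) ω X) {y : X}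
    (hy : y ∈ c.source) : MDifferentiableAt 𝓘(ℂ, ℂ) 𝓘(ℂ, ℂ) c y :=
  (contMDiffAt_of_mem_maximalAtlas hc hy).mdifferentiableAt (by simp)

theorem mdifferentiableAt_chart_symm (hc : c ∈ IsManifold.maximalAtlas 𝓘(ℂ, ℂ) ω X) {y : X}
    (hy : y ∈ c.source) : MDifferentiableAt 𝓘(ℂ, ℂ) 𝓘(ℂ, ℂ) c.symm (c y) :=
  (contMDiffAt_symm_of_mem_maximalAtlas hc (c.map_source hy)).mdifferentiableAt (by simp)

theorem differentiableAt_comp_chart_symm (hc : c ∈ IsManifold.maximalAtlas 𝓘(ℂ, ℂ) ω X) {y : X}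
    (hy : y ∈ c.source) {f : X → F} (hf : MDifferentiableAt 𝓘(ℂ, ℂ) 𝓘(ℂ, F) f y) :
    DifferentiableAt ℂ (fun z => f (c.symm z)) (c y) := by
  rw [← mdifferentiableAt_iff_differentiableAt]
  refine MDifferentiableAt.comp (c y) (g := f) ?_ (mdifferentiableAt_chart_symm hc hy)
  rwa [c.left_inv hy]

theorem mdifferentiableAt_comp_chart (hc : c ∈ IsManifold.maximalAtlas 𝓘(ℂ, ℂ) ω X) {y : X}
    (hy : y ∈ c.source) {h : ℂ → F} (hh : DifferentiableAt ℂ h (c y)) :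
    MDifferentiableAt 𝓘(ℂ, ℂ) 𝓘(ℂ, F) (fun y => h (c y)) y :=
  MDifferentiableAt.comp y (g := h) hh.mdifferentiableAt (mdifferentiableAt_chart hc hy)

/-- Vanishing of the derivative at a point does not depend on the coordinate. -/
theorem deriv_comp_chart_symm_eq_zero {c' : OpenPartialHomeomorph X ℂ}
    (hc : c ∈ IsManifold.maximalAtlas 𝓘(ℂ, ℂ) ω X)
    (hc' : c' ∈ IsManifold.maximalAtlas 𝓘(ℂ, ℂ) ω X) {y : X}
    (hy : y ∈ c.source) (hy' : y ∈ c'.source) {f : X → ℂ}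
    (hf : MDifferentiableAt 𝓘(ℂ, ℂ) 𝓘(ℂ, ℂ) f y)
    (h : deriv (fun z => f (c.symm z)) (c y) = 0) :
    deriv (fun z => f (c'.symm z)) (c' y) = 0 := by
  have h1 : DifferentiableAt ℂ (fun z => c (c'.symm z)) (c' y) :=
    differentiableAt_comp_chart_symm hc' hy' (mdifferentiableAt_chart hc hy)
  have h2 : (fun z => f (c'.symm z)) =ᶠ[𝓝 (c' y)]
      (fun z => f (c.symm z)) ∘ (fun z => c (c'.symm z)) := by
    have : c'.symm ⁻¹' c.source ∈ 𝓝 (c' y) :=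
      (c'.continuousAt_symm (c'.map_source hy')).preimage_mem_nhds
        (by rw [c'.left_inv hy']; exact c.open_source.mem_nhds hy)
    filter_upwards [this] with z hz
    simp only [Function.comp, c.left_inv hz]
  have h3 : c (c'.symm (c' y)) = c y := by rw [c'.left_inv hy']
  rw [h2.deriv_eq, deriv_comp _ (by rw [h3]; exact differentiableAt_comp_chart_symm hc hy hf) h1,
    h3, h, zero_mul]

end Charts

section Sections

variable {X : Type u} [TopologicalSpace X] [ChartedSpace ℂ X]
  {F : Type*} [NormedAddCommGroup F] [NormedSpace ℂ F]
  {E : X → Type w} [TopologicalSpace (TotalSpace F E)]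
  [∀ x, AddCommGroup (E x)] [∀ x, Module ℂ (E x)] [∀ x, TopologicalSpace (E x)]
  [FiberBundle F E]
  {L : X → Type v} [TopologicalSpace (TotalSpace ℂ L)]
  [∀ x, AddCommGroup (L x)] [∀ x, Module ℂ (L x)] [∀ x, TopologicalSpace (L x)] [FiberBundle ℂ L]
  {U W : Set X}

theorem HolFun.mono {f : X → ℂ} (hf : HolFun U f) (h : W ⊆ U) : HolFun W f :=
  MDifferentiableOn.mono hf h

theorem HolFun.mdifferentiableAt {f : X → ℂ} (hf : HolFun U f) (hU : IsOpen U) {x : X}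
    (hx : x ∈ U) : MDifferentiableAt 𝓘(ℂ, ℂ) 𝓘(ℂ, ℂ) f x :=
  MDifferentiableOn.mdifferentiableAt hf (hU.mem_nhds hx)

theorem HolFun.mul {f g : X → ℂ} (hf : HolFun U f) (hg : HolFun U g) :
    HolFun U (fun x => f x * g x) := MDifferentiableOn.mul hf hg

theorem HolFun.add {f g : X → ℂ} (hf : HolFun U f) (hg : HolFun U g) :
    HolFun U (fun x => f x + g x) := MDifferentiableOn.add hf hg

theorem HolFun.pow {f : X → ℂ} (hf : HolFun U f) (m : ℕ) : HolFun U (fun x => f x ^ m) :=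
  MDifferentiableOn.pow hf m

theorem HolSec.mono {s : ∀ x, E x} (hs : HolSec F U s) (h : W ⊆ U) : HolSec F W s :=
  MDifferentiableOn.mono hs h

theorem HolSec.congr {s t : ∀ x, E x} (hs : HolSec F U s) (h : ∀ x ∈ U, t x = s x) :
    HolSec F U t :=
  MDifferentiableOn.congr hs fun x hx => by rw [h x hx]

theorem HolDual.mono {ξ : ∀ x, DualFibre L x} (hξ : HolDual U ξ) (h : W ⊆ U) : HolDual W ξ :=
  fun W' l hW' hW l' => hξ W' l hW' (hW.trans h) l'

theorem HolNegPow.mono {n : ℕ} {t : ∀ x, NegPowFibre L n x} (ht : HolNegPow U t) (h : W ⊆ U) :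
    HolNegPow W t :=
  fun W' l hW' hW l' => ht W' l hW' (hW.trans h) l'

theorem HolTwist.mono {t : ∀ x, TwistFibre L E x} (ht : HolTwist F U t) (h : W ⊆ U) :
    HolTwist F W t :=
  fun W' l hW' hW l' => ht W' l hW' (hW.trans h) l'

theorem HolNegPow.add {n : ℕ} {t t' : ∀ x, NegPowFibre L n x} (ht : HolNegPow U t)
    (ht' : HolNegPow U t') : HolNegPow U (fun x => t x + t' x) := fun W l hW hWU hl =>
  (ht W l hW hWU hl).add (ht' W l hW hWU hl)

theorem HolNegPow.zero {n : ℕ} : HolNegPow U (fun x => (0 : NegPowFibre L n x)) :=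
  fun _ _ _ _ _ => mdifferentiableOn_const

theorem HolNegPow.smul {n : ℕ} {f : X → ℂ} {t : ∀ x, NegPowFibre L n x} (hf : HolFun U f)
    (ht : HolNegPow U t) : HolNegPow U (fun x => f x • t x) := fun W l hW hWU hl =>
  (hf.mono hWU).mul (ht W l hW hWU hl)

variable [VectorBundle ℂ F E]

theorem HolSec.smul {f : X → ℂ} {s : ∀ x, E x} (hf : HolFun U f) (hs : HolSec F U s) :
    HolSec F U (fun x => f x • s x) :=
  MDifferentiableOn.smul_section (f := f) (s := s) hf hs

theorem HolTwist.add {t t' : ∀ x, TwistFibre L E x} (ht : HolTwist F U t)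
    (ht' : HolTwist F U t') : HolTwist F U (fun x => t x + t' x) := fun W l hW hWU hl =>
  mdifferentiableOn_add_section (s := fun x => t x (l x)) (t := fun x => t' x (l x))
    (ht W l hW hWU hl) (ht' W l hW hWU hl)

theorem HolTwist.smul {f : X → ℂ} {t : ∀ x, TwistFibre L E x} (hf : HolFun U f)
    (ht : HolTwist F U t) : HolTwist F U (fun x => f x • t x) := fun W l hW hWU hl =>
  HolSec.smul (hf.mono hWU) (ht W l hW hWU hl)

variable [ContMDiffVectorBundle ω F E 𝓘(ℂ, ℂ)]
  (e : Trivialization F (π F E)) [MemTrivializationAtlas e]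

theorem holSec_iff (hU : IsOpen U) (hUe : U ⊆ e.baseSet) {s : ∀ x, E x} :
    HolSec F U s ↔
      MDifferentiableOn 𝓘(ℂ, ℂ) 𝓘(ℂ, F) (fun y => e.linearMapAt ℂ y (s y)) U := by
  have : ContMDiffVectorBundle 1 F E 𝓘(ℂ, ℂ) := ContMDiffVectorBundle.of_le (n := ω) le_top
  have h := e.mdifferentiableOn_section_iff (IB := 𝓘(ℂ, ℂ)) (s := s) hU hUe
  refine h.trans (mdifferentiableOn_congr fun y hy => ?_)
  rw [e.coe_linearMapAt_of_mem (hUe hy)]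

theorem holSec_symm (hU : IsOpen U) (hUe : U ⊆ e.baseSet) (a : F) :
    HolSec F U (fun y => e.symmₗ ℂ y a) := by
  rw [holSec_iff e hU hUe]
  exact (mdifferentiableOn_const (c := a)).congr fun y hy => e.linearMapAt_symmₗ (hUe hy) a

end Sections

/-! ### Frames of `L`, `L⁻¹` and `L⁻ⁿ` -/

section LineBundle

variable {X : Type u} [TopologicalSpace X] [ChartedSpace ℂ X]
  {L : X → Type v} [TopologicalSpace (TotalSpace ℂ L)]
  [∀ x, AddCommGroup (L x)] [∀ x, Module ℂ (L x)] [∀ x, TopologicalSpace (L x)] [FiberBundle ℂ L]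
  [VectorBundle ℂ ℂ L]
  {n : ℕ} {E : X → Type w} [TopologicalSpace (TotalSpace (Model n) E)]
  [∀ x, AddCommGroup (E x)] [∀ x, Module ℂ (E x)] [∀ x, TopologicalSpace (E x)]
  [FiberBundle (Model n) E] [VectorBundle ℂ (Model n) E]

namespace LocalData

variable {x : X} (d : LocalData n L E x) {y : X} {U : Set X}

theorem coframe_frame (hy : y ∈ d.trivL.baseSet) : d.coframe y (d.frame y) = 1 :=
  d.trivL.linearMapAt_symmₗ hy 1

theorem coframe_smul_frame (hy : y ∈ d.trivL.baseSet) (l : L y) :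
    d.coframe y l • d.frame y = l := by
  rw [frame, ← map_smul, smul_eq_mul, mul_one]
  exact d.trivL.symmₗ_linearMapAt hy l

theorem smul_coframe (hy : y ∈ d.trivL.baseSet) (ξ : DualFibre L y) :
    ξ (d.frame y) • d.coframe y = ξ := by
  refine LinearMap.ext fun l => ?_
  conv_rhs => rw [← d.coframe_smul_frame hy l, map_smul]
  simp [mul_comm]

theorem twist_ext (hy : y ∈ d.trivL.baseSet) {t t' : TwistFibre L E y}
    (h : t (d.frame y) = t' (d.frame y)) : t = t' := by
  refine LinearMap.ext fun l => ?_
  rw [← d.coframe_smul_frame hy l, map_smul, map_smul, h]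

theorem negPow_ext (hy : y ∈ d.trivL.baseSet) {w w' : NegPowFibre L n y}
    (h : w (fun _ => d.frame y) = w' (fun _ => d.frame y)) : w = w' := by
  refine MultilinearMap.ext fun m => ?_
  have hm : m = fun i => d.coframe y (m i) • d.frame y :=
    funext fun i => (d.coframe_smul_frame hy (m i)).symm
  rw [hm, MultilinearMap.map_smul_univ, MultilinearMap.map_smul_univ, h]

/-- The frame of `L⁻ⁿ` given by the trivialisation. -/
def negPowFrame (y : X) : NegPowFibre L n y :=
  (MultilinearMap.mkPiAlgebra ℂ (Fin n) ℂ).compLinearMap fun _ => d.coframe y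

theorem negPowFrame_apply (y : X) (l : L y) :
    d.negPowFrame y (fun _ => l) = d.coframe y l ^ n := by
  simp [negPowFrame]

theorem negPowFrame_frame (hy : y ∈ d.trivL.baseSet) :
    d.negPowFrame y (fun _ => d.frame y) = 1 := by
  rw [negPowFrame_apply, d.coframe_frame hy, one_pow]

theorem negPow_eq_smul (hy : y ∈ d.trivL.baseSet) (w : NegPowFibre L n y) :
    w = w (fun _ => d.frame y) • d.negPowFrame y :=
  d.negPow_ext hy (by simp [d.negPowFrame_frame hy])

/-- As `L_y` is spanned by the frame, each tensor is the frame tensored with its contraction. This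
lets vanishing of `Φ` be tested on the endomorphism `H.endo`. -/
theorem contract_eq_zero (hy : y ∈ d.trivL.baseSet) {t : L y ⊗[ℂ] E y}
    (h : contract (d.coframe y) t = 0) : t = 0 := by
  have key : ∀ t : L y ⊗[ℂ] E y, t = d.frame y ⊗ₜ[ℂ] contract (d.coframe y) t := by
    intro t
    induction t using TensorProduct.induction_on with
    | zero => simp
    | tmul l e =>
      simp only [contract, LinearMap.comp_apply, LinearMap.rTensor_tmul, LinearEquiv.coe_coe,
        TensorProduct.lid_tmul]
      rw [TensorProduct.tmul_smul, TensorProduct.smul_tmul', d.coframe_smul_frame hy]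
    | add a b ha hb => rw [map_add, TensorProduct.tmul_add, ← ha, ← hb]
  rw [key t, h, TensorProduct.tmul_zero]

variable [ContMDiffVectorBundle ω ℂ L 𝓘(ℂ, ℂ)]

theorem holDual_coframe (hU : U ⊆ d.trivL.baseSet) : HolDual U d.coframe :=
  fun _ _ hW hWU hl => (holSec_iff d.trivL hW (hWU.trans hU)).1 hl

theorem holSec_frame (hUo : IsOpen U) (hU : U ⊆ d.trivL.baseSet) : HolSec ℂ U d.frame :=
  holSec_symm d.trivL hUo hU 1

/-- Every holomorphic section of `L` is a holomorphic function times the frame, so one test section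
is enough. -/
theorem holTwist_of_frame {F : Type*} [NormedAddCommGroup F] [NormedSpace ℂ F]
    {E' : X → Type w} [TopologicalSpace (TotalSpace F E')]
    [∀ x, AddCommGroup (E' x)] [∀ x, Module ℂ (E' x)] [∀ x, TopologicalSpace (E' x)]
    [FiberBundle F E'] [VectorBundle ℂ F E'] (hU : U ⊆ d.trivL.baseSet)
    {t : ∀ y, TwistFibre L E' y} (h : HolSec F U (fun y => t y (d.frame y))) :
    HolTwist F U t := by
  intro W l hW hWU hl
  refine (HolSec.smul (d.holDual_coframe hU W l hW hWU hl) (h.mono hWU)).congr fun y hy => ?_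
  rw [← map_smul, d.coframe_smul_frame (hU (hWU hy))]

theorem holNegPow_negPowFrame (hU : U ⊆ d.trivL.baseSet) : HolNegPow U d.negPowFrame := by
  intro W l hW hWU hl
  simp only [negPowFrame_apply]
  exact (d.holDual_coframe hU W l hW hWU hl).pow n

end LocalData

end LineBundle

/-! ### The Higgs field near a zero of its determinant -/

section HiggsLocal

variable {X : Type u} [TopologicalSpace X] [ChartedSpace ℂ X]
  {n : ℕ}
  {L : X → Type v} [TopologicalSpace (TotalSpace ℂ L)]
  [∀ x, AddCommGroup (L x)] [∀ x, Module ℂ (L x)] [∀ x, TopologicalSpace (L x)] [FiberBundle ℂ L]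
  {E : X → Type w} [TopologicalSpace (TotalSpace (Model n) E)]
  [∀ x, AddCommGroup (E x)] [∀ x, Module ℂ (E x)] [∀ x, TopologicalSpace (E x)]
  [FiberBundle (Model n) E]
  [VectorBundle ℂ ℂ L] [VectorBundle ℂ (Model n) E]

theorem finrank_fibre (x : X) : Module.finrank ℂ (E x) = 2 * n := by
  rw [((trivializationAt (Model n) E x).linearEquivAt ℂ x
    (mem_baseSet_trivializationAt (Model n) E x)).finrank_eq]
  simp [Model]

namespace SpHiggs

variable (H : SpHiggs n L E)

theorem endo_smul (x : X) (k : ℂ) (ξ : DualFibre L x) : H.endo x (k • ξ) = k • H.endo x ξ := by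
  ext e
  simp [SpHiggs.endo, contract, LinearMap.rTensor_smul]

theorem charCoeff_eq_det (x : X) (ξ : DualFibre L x) :
    H.charCoeff (2 * n) x ξ = LinearMap.det (H.endo x ξ) := by
  have := finite_fibre (n := n) (E := E) x
  rw [LinearMap.det_eq_sign_charpoly_coeff, finrank_fibre (n := n) x]
  simp [SpHiggs.charCoeff, SpHiggs.charPoly]

theorem endo_skew (x : X) (ξ : DualFibre L x) (e e' : E x) :
    H.form x (H.endo x ξ e) e' + H.form x e (H.endo x ξ e') = 0 :=
  H.compatible x ξ e e'

end SpHiggs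

namespace LocalData

variable {x : X} (d : LocalData n L E x) (H : SpHiggs n L E) {y : X}

/-- The open set on which the local coordinate and both trivialisations are defined. -/
def domain : Set X := d.chart.source ∩ (d.trivL.baseSet ∩ d.trivE.baseSet)

theorem isOpen_domain : IsOpen d.domain :=
  d.chart.open_source.inter (d.trivL.open_baseSet.inter d.trivE.open_baseSet)

theorem mem_domain : x ∈ d.domain := ⟨d.mem_source, d.mem_trivL, d.mem_trivE⟩

theorem mem_D_iff (hy : y ∈ d.trivL.baseSet) :
    y ∈ H.D ↔ H.charCoeff (2 * n) y (d.coframe y) = 0 := by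
  refine ⟨fun h => h _, fun h ξ => ?_⟩
  rw [← d.smul_coframe hy ξ, H.charCoeff_smul, h, mul_zero]

theorem mem_twistKer_iff (hy : y ∈ d.trivL.baseSet) (t : TwistFibre L E y) :
    t ∈ H.twistKer y ↔ H.endo y (d.coframe y) (t (d.frame y)) = 0 := by
  change H.Φ y ∘ₗ t = 0 ↔ _
  refine ⟨fun h => ?_, fun h => LinearMap.ext fun l => ?_⟩
  · have h1 := LinearMap.congr_fun h (d.frame y)
    change contract (d.coframe y) ((H.Φ y ∘ₗ t) (d.frame y)) = 0
    rw [h1]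
    simp
  · have h1 : H.Φ y (t (d.frame y)) = 0 := d.contract_eq_zero hy h
    rw [← d.coframe_smul_frame hy l]
    simp [h1]

/-- The dictionary between the fibrewise endomorphism and the matrix family to which the determinant
lemmas apply. -/
theorem higgs_linearMapAt (hy : y ∈ d.domain) (e : E y) :
    d.higgs H (d.chart y) (d.trivE.linearMapAt ℂ y e) =
      d.trivE.linearMapAt ℂ y (H.endo y (d.coframe y) e) := by
  unfold higgs
  rw [d.chart.left_inv hy.1]
  simp only [LinearMap.comp_apply, d.trivE.symmₗ_linearMapAt hy.2.2]

theorem det_higgs (hy : y ∈ d.domain) :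
    LinearMap.det (d.higgs H (d.chart y)) = d.coeffFun H (2 * n) (d.chart y) := by
  unfold higgs coeffFun
  rw [d.chart.left_inv hy.1, H.charCoeff_eq_det,
    ← LinearMap.det_conj _ (d.trivE.linearEquivAt ℂ y hy.2.2)]
  -- `symmₗ` is defined at every point of `X`, and is the inverse equivalence only over the base
  -- set.
  have hs : d.trivE.symmₗ ℂ y =
      ((d.trivE.linearEquivAt ℂ y hy.2.2).symm : Model n →ₗ[ℂ] E y) := by
    refine LinearMap.ext fun v => (d.trivE.linearEquivAt ℂ y hy.2.2).injective ?_
    have := d.trivE.linearMapAt_symmₗ (R := ℂ) hy.2.2 v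
    rw [d.trivE.linearMapAt_def_of_mem hy.2.2] at this
    exact this.trans (LinearEquiv.apply_symm_apply _ v).symm
  rw [d.trivE.linearMapAt_def_of_mem hy.2.2, hs]

theorem eventually_symm_mem_domain (hy : y ∈ d.domain) :
    ∀ᶠ z in 𝓝 (d.chart y), z ∈ d.chart.target ∧ d.chart.symm z ∈ d.domain :=
  Filter.Eventually.and (d.chart.open_target.mem_nhds (d.chart.map_source hy.1))
    ((d.chart.continuousAt_symm (d.chart.map_source hy.1)).preimage_mem_nhds
      (by rw [d.chart.left_inv hy.1]; exact d.isOpen_domain.mem_nhds hy))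

/-- Makes `e ↦ ω(e, Φ'_x e)` homogeneous of degree two, which is the source of the sign ambiguity.
-/
theorem higgsDeriv_smul (c : ℂ) (e : E x) :
    d.higgsDeriv H (c • e) = c • d.higgsDeriv H e := by
  unfold higgsDeriv
  simp only [map_smul]
  rw [← map_smul]
  congr 1
  exact deriv_fun_const_smul_field c _

variable [ContMDiffVectorBundle ω ℂ L 𝓘(ℂ, ℂ)]
  [ContMDiffVectorBundle ω (Model n) E 𝓘(ℂ, ℂ)]

theorem holSec_endo {U : Set X} (hU : IsOpen U) (hUd : U ⊆ d.trivL.baseSet) {s : ∀ y, E y}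
    (hs : HolSec (Model n) U s) :
    HolSec (Model n) U (fun y => H.endo y (d.coframe y) (s y)) :=
  H.hol_Φ U d.coframe s hU (d.holDual_coframe hUd) hs

theorem differentiableAt_higgs (hy : y ∈ d.domain) (v : Model n) :
    DifferentiableAt ℂ (fun z => d.higgs H z v) (d.chart y) := by
  have hsub : d.domain ⊆ d.trivE.baseSet := fun y hy => hy.2.2
  have h1 := d.holSec_endo H d.isOpen_domain (fun y hy => hy.2.1)
    (holSec_symm d.trivE d.isOpen_domain hsub v)
  rw [holSec_iff d.trivE d.isOpen_domain hsub] at h1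
  exact differentiableAt_comp_chart_symm d.chart_mem hy.1
    (h1.mdifferentiableAt (d.isOpen_domain.mem_nhds hy))

theorem eventuallyEq_det_higgs (hy : y ∈ d.domain) :
    (fun z => LinearMap.det (d.higgs H z)) =ᶠ[𝓝 (d.chart y)] d.coeffFun H (2 * n) := by
  filter_upwards [d.eventually_symm_mem_domain hy] with z hz
  have := d.det_higgs H hz.2
  rwa [d.chart.right_inv hz.1] at this

theorem differentiableAt_coeffFun (hy : y ∈ d.domain) :
    DifferentiableAt ℂ (d.coeffFun H (2 * n)) (d.chart y) :=
  (differentiableAt_det (d.differentiableAt_higgs H hy)).congr_of_eventuallyEq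
    (d.eventuallyEq_det_higgs H hy).symm

/-- Holomorphy of `a₂ₙ` is not part of the Higgs data; it comes from the determinant of the
holomorphic matrix family. -/
theorem holFun_charCoeff :
    HolFun d.domain (fun y => H.charCoeff (2 * n) y (d.coframe y)) := by
  have h : HolFun d.domain (fun y => d.coeffFun H (2 * n) (d.chart y)) := fun y hy =>
    (mdifferentiableAt_comp_chart d.chart_mem hy.1
      (d.differentiableAt_coeffFun H hy)).mdifferentiableWithinAt
  refine MDifferentiableOn.congr h fun y hy => ?_
  simp only [coeffFun]
  rw [d.chart.left_inv hy.1]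

end LocalData

namespace SpHiggs

variable (H : SpHiggs n L E)

theorem charPoly_coeff_one {x : X} (d : LocalData n L E x) :
    (H.charPoly x (d.coframe x)).coeff 1 = 0 := by
  have := finite_fibre (n := n) (E := E) x
  refine charpoly_coeff_one_eq_zero (finrank_fibre (n := n) x)
    ((H.form x).compr₂ (d.coframe x)) (fun v hv => H.nondegenerate x v fun w => ?_) _
    fun v w => ?_
  · rw [← d.coframe_smul_frame d.mem_trivL (H.form x v w)]
    have := hv w
    rw [LinearMap.compr₂_apply] at this
    rw [this, zero_smul]
  · rw [LinearMap.compr₂_apply, LinearMap.compr₂_apply, ← map_add, H.endo_skew, map_zero]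

/-- Where the spectral curve is smooth, `a₂ₙ` has simple zeros. -/
theorem deriv_coeffFun_ne_zero (hS : H.SpectralCurveSmooth) {x : X} (hx : x ∈ H.D)
    (d : LocalData n L E x) : deriv (d.coeffFun H (2 * n)) (d.chart x) ≠ 0 := by
  intro h0
  have hcoeff : ∀ y, (H.charPoly y (d.coframe y)).eval 0 = H.charCoeff (2 * n) y (d.coframe y) := by
    intro y
    rw [← Polynomial.coeff_zero_eq_eval_zero, charCoeff, Nat.sub_self]
  have hne := hS x d 0 (by rw [hcoeff]; exact hx _)
  set P : ℂ × ℂ → ℂ := fun q =>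
    (H.charPoly (d.chart.symm q.2) (d.coframe (d.chart.symm q.2))).eval q.1 with hP
  -- `fderiv` takes the value zero where the derivative does not exist, so its non-vanishing
  -- supplies differentiability.
  have hdiff : DifferentiableAt ℂ P (0, d.chart x) := by
    by_contra hcon
    exact hne (fderiv_zero_of_not_differentiableAt hcon)
  -- The derivative along the fibre is the linear coefficient of the characteristic polynomial, zero
  -- by skewness.
  have h1 : fderiv ℂ P (0, d.chart x) (1, 0) = 0 := by
    have hc : HasDerivAt (fun t : ℂ => (t, d.chart x)) ((1 : ℂ), (0 : ℂ)) 0 :=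
      (hasDerivAt_id (0 : ℂ)).prodMk (hasDerivAt_const _ _)
    have h2 := hdiff.hasFDerivAt.comp_hasDerivAt (0 : ℂ) hc
    have h3 : P ∘ (fun t : ℂ => (t, d.chart x)) =
        fun t => (H.charPoly x (d.coframe x)).eval t := by
      funext t
      simp only [hP, Function.comp]
      rw [d.chart.left_inv d.mem_source]
    rw [h3] at h2
    rw [← h2.deriv, Polynomial.deriv, ← Polynomial.coeff_zero_eq_eval_zero,
      Polynomial.coeff_derivative, zero_add, H.charPoly_coeff_one, zero_mul]
  have h2 : fderiv ℂ P (0, d.chart x) (0, 1) = 0 := by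
    have hc : HasDerivAt (fun z : ℂ => ((0 : ℂ), z)) ((0 : ℂ), (1 : ℂ)) (d.chart x) :=
      (hasDerivAt_const _ _).prodMk (hasDerivAt_id _)
    have h2 := hdiff.hasFDerivAt.comp_hasDerivAt (d.chart x) hc
    have h3 : P ∘ (fun z : ℂ => ((0 : ℂ), z)) = d.coeffFun H (2 * n) :=
      funext fun z => hcoeff _
    rw [h3] at h2
    rw [← h2.deriv, h0]
  refine hne (ContinuousLinearMap.ext fun q => ?_)
  have hq : q = q.1 • ((1 : ℂ), (0 : ℂ)) + q.2 • ((0 : ℂ), (1 : ℂ)) := by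
    ext <;> simp
  rw [hq, map_add, map_smul, map_smul, h1, h2]
  simp

theorem exists_ker {x : X} (hx : x ∈ H.D) (ξ : DualFibre L x) :
    ∃ e : E x, e ≠ 0 ∧ H.endo x ξ e = 0 := by
  have := finite_fibre (n := n) (E := E) x
  have h0 : LinearMap.det (H.endo x ξ) = 0 := by rw [← H.charCoeff_eq_det]; exact hx ξ
  obtain ⟨e, he, hne⟩ := (Submodule.ne_bot_iff _).1 (LinearMap.bot_lt_ker_of_det_eq_zero h0).ne'
  exact ⟨e, hne, he⟩

variable [ContMDiffVectorBundle ω ℂ L 𝓘(ℂ, ℂ)]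
  [ContMDiffVectorBundle ω (Model n) E 𝓘(ℂ, ℂ)] {H}

theorem deriv_det_higgs_ne_zero (hS : H.SpectralCurveSmooth) {x : X} (hx : x ∈ H.D)
    (d : LocalData n L E x) :
    deriv (fun z => LinearMap.det (d.higgs H z)) (d.chart x) ≠ 0 := by
  rw [(d.eventuallyEq_det_higgs H d.mem_domain).deriv_eq]
  exact H.deriv_coeffFun_ne_zero hS hx d

theorem linearMapAt_ne_zero {x : X} (d : LocalData n L E x) {e : E x} (he : e ≠ 0) :
    d.trivE.linearMapAt ℂ x e ≠ 0 := fun h => he <| by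
  rw [← d.trivE.symmₗ_linearMapAt (R := ℂ) d.mem_trivE e, h, map_zero]

/-- The kernel of `Φ_x` is a line for `x ∈ D`. -/
theorem exists_eq_smul_of_mem_ker (hS : H.SpectralCurveSmooth) {x : X} (hx : x ∈ H.D)
    (d : LocalData n L E x) {e e' : E x} (he0 : e ≠ 0) (he : H.endo x (d.coframe x) e = 0)
    (he' : H.endo x (d.coframe x) e' = 0) : ∃ c : ℂ, e' = c • e := by
  obtain ⟨c, hc⟩ := ker_eq_span_of_deriv_det_ne_zero (d.differentiableAt_higgs H d.mem_domain)
    (deriv_det_higgs_ne_zero hS hx d) (linearMapAt_ne_zero d he0)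
    (by rw [d.higgs_linearMapAt H d.mem_domain, he, map_zero])
    (u := d.trivE.linearMapAt ℂ x e')
    (by rw [d.higgs_linearMapAt H d.mem_domain, he', map_zero])
  refine ⟨c, ?_⟩
  rw [← d.trivE.symmₗ_linearMapAt (R := ℂ) d.mem_trivE e', hc, map_smul,
    d.trivE.symmₗ_linearMapAt d.mem_trivE]

/-- `ω_x(e, Φ'_x e)` is non-zero for a generator `e` of the kernel of `Φ_x`, `x ∈ D`. -/
theorem form_higgsDeriv_ne_zero (hS : H.SpectralCurveSmooth) {x : X} (hx : x ∈ H.D)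
    (d : LocalData n L E x) {e : E x} (he0 : e ≠ 0) (he : H.endo x (d.coframe x) e = 0) :
    d.coframe x (H.form x e (d.higgsDeriv H e)) ≠ 0 := by
  intro h0
  -- The functional is `ω(e, ·)`: it kills the image of `Φ_x` by skewness and `Φ'_x e` by
  -- assumption, hence everything, against non-degeneracy.
  have hψ := eq_zero_of_deriv_det_ne_zero (d.differentiableAt_higgs H d.mem_domain)
    (deriv_det_higgs_ne_zero hS hx d) (linearMapAt_ne_zero d he0)
    (by rw [d.higgs_linearMapAt H d.mem_domain, he, map_zero])
    (d.coframe x ∘ₗ H.form x e ∘ₗ d.trivE.symmₗ ℂ x) (fun u => ?_) h0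
  · refine he0 (H.nondegenerate x e fun e' => ?_)
    have h1 := LinearMap.congr_fun hψ (d.trivE.linearMapAt ℂ x e')
    simp only [LinearMap.comp_apply, d.trivE.symmₗ_linearMapAt d.mem_trivE,
      LinearMap.zero_apply] at h1
    rw [← d.coframe_smul_frame d.mem_trivL (H.form x e e'), h1, zero_smul]
  · have h1 := d.higgs_linearMapAt H d.mem_domain (d.trivE.symmₗ ℂ x u)
    rw [d.trivE.linearMapAt_symmₗ d.mem_trivE] at h1
    have h2 := H.endo_skew x (d.coframe x) e (d.trivE.symmₗ ℂ x u)
    rw [he, map_zero, LinearMap.zero_apply, zero_add] at h2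
    simp only [LinearMap.comp_apply]
    rw [h1, d.trivE.symmₗ_linearMapAt d.mem_trivE, h2, map_zero]

variable [IsManifold 𝓘(ℂ, ℂ) ω X]

theorem isClosed_D (H : SpHiggs n L E) : IsClosed H.D := by
  rw [← isOpen_compl_iff, isOpen_iff_mem_nhds]
  intro x hx
  obtain ⟨d⟩ := LocalData.nonempty (n := n) (L := L) (E := E) x
  have hc := ((d.holFun_charCoeff H).mdifferentiableAt d.isOpen_domain d.mem_domain).continuousAt
  have h0 : H.charCoeff (2 * n) x (d.coframe x) ≠ 0 := fun h => hx ((d.mem_D_iff H d.mem_trivL).2 h)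
  filter_upwards [hc.eventually_ne h0, d.isOpen_domain.mem_nhds d.mem_domain] with y hy hyd hyD
  exact hy ((d.mem_D_iff H hyd.2.1).1 hyD)

/-- A function with non-zero derivative takes its value only once near the point, so `D` is
discrete. -/
theorem exists_isOpen_inter_D_subset (hS : H.SpectralCurveSmooth) {x : X} (hx : x ∈ H.D) :
    ∃ U : Set X, IsOpen U ∧ x ∈ U ∧ ∀ y ∈ U, y ∈ H.D → y = x := by
  obtain ⟨d⟩ := LocalData.nonempty (n := n) (L := L) (E := E) x
  have h1 := ((d.differentiableAt_coeffFun H d.mem_domain).hasDerivAt).eventually_ne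
    (c := 0) (H.deriv_coeffFun_ne_zero hS hx d)
  rw [eventually_nhdsWithin_iff] at h1
  have h2 : ∀ᶠ y in 𝓝 x, d.chart y ∈ ({d.chart x}ᶜ : Set ℂ) →
      d.coeffFun H (2 * n) (d.chart y) ≠ 0 :=
    (d.chart.continuousAt d.mem_source).eventually h1
  obtain ⟨U, hU, hUo, hxU⟩ := mem_nhds_iff.1
    (h2.and (d.isOpen_domain.mem_nhds d.mem_domain))
  refine ⟨U, hUo, hxU, fun y hy hyD => ?_⟩
  by_contra hne
  have h3 := (hU hy).1 fun h => hne (d.chart.injOn (hU hy).2.1 d.mem_source h)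
  simp only [LocalData.coeffFun] at h3
  rw [d.chart.left_inv (hU hy).2.1] at h3
  exact h3 (hyD _)

end SpHiggs

end HiggsLocal

/-! ### The quadratic form on holomorphic sections -/

section Quad

variable {X : Type u} [TopologicalSpace X] [ChartedSpace ℂ X]
  {n : ℕ}
  {L : X → Type v} [TopologicalSpace (TotalSpace ℂ L)]
  [∀ x, AddCommGroup (L x)] [∀ x, Module ℂ (L x)] [∀ x, TopologicalSpace (L x)] [FiberBundle ℂ L]
  {E : X → Type w} [TopologicalSpace (TotalSpace (Model n) E)]
  [∀ x, AddCommGroup (E x)] [∀ x, Module ℂ (E x)] [∀ x, TopologicalSpace (E x)]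
  [FiberBundle (Model n) E]
  [VectorBundle ℂ ℂ L] [VectorBundle ℂ (Model n) E]

theorem LocalData.quad_eq {x : X} (d : LocalData n L E x) (H : SpHiggs n L E) {y : X}
    (hy : y ∈ d.trivL.baseSet) (s : SumFibre L E n y) :
    H.quad y s = d.coframe y (H.form y (s.1 (d.frame y))
      (H.endo y (d.coframe y) (s.1 (d.frame y)))) +
        (s.2 fun _ => d.frame y) ^ 2 * H.charCoeff (2 * n) y (d.coframe y) :=
  H.quad_eq y _ _ (d.coframe_frame hy) s

theorem SpHiggs.quad_smul (H : SpHiggs n L E) (x : X) (c : ℂ) (s : SumFibre L E n x) :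
    H.quad x (c • s) = c ^ 2 * H.quad x s := by
  simp only [SpHiggs.quad, SpHiggs.quadWith, Prod.smul_fst, Prod.smul_snd, LinearMap.smul_apply,
    smul_apply, map_smul, smul_eq_mul]
  ring

theorem SpHiggs.Q_self (H : SpHiggs n L E) (x : X) (s : SumFibre L E n x) :
    H.Q x s s = H.quad x s := by
  rw [SpHiggs.Q, ← two_smul ℂ s, H.quad_smul]
  ring

variable [ContMDiffVectorBundle ω ℂ L 𝓘(ℂ, ℂ)]
  [ContMDiffVectorBundle ω (Model n) E 𝓘(ℂ, ℂ)] {H : SpHiggs n L E}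
  {U : Set X} {s : ∀ y, SumFibre L E n y}

theorem HolTwist.holSec_frame {F : Type*} [NormedAddCommGroup F] [NormedSpace ℂ F]
    {E' : X → Type w} [TopologicalSpace (TotalSpace F E')]
    [∀ x, AddCommGroup (E' x)] [∀ x, Module ℂ (E' x)] [∀ x, TopologicalSpace (E' x)]
    [FiberBundle F E'] {t : ∀ y, TwistFibre L E' y} (ht : HolTwist F U t) {x : X}
    (d : LocalData n L E x) (hU : IsOpen U) (hUd : U ⊆ d.trivL.baseSet) :
    HolSec F U (fun y => t y (d.frame y)) :=
  ht U d.frame hU subset_rfl (d.holSec_frame hU hUd)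

theorem HolNegPow.holFun_frame {t : ∀ y, NegPowFibre L n y} (ht : HolNegPow U t) {x : X}
    (d : LocalData n L E x) (hU : IsOpen U) (hUd : U ⊆ d.trivL.baseSet) :
    HolFun U (fun y => t y (fun _ => d.frame y)) :=
  ht U d.frame hU subset_rfl (d.holSec_frame hU hUd)

theorem LocalData.holFun_form {x : X} (d : LocalData n L E x) (H : SpHiggs n L E)
    (hU : IsOpen U) (hUd : U ⊆ d.trivL.baseSet) {r t : ∀ y, E y}
    (hr : HolSec (Model n) U r) (ht : HolSec (Model n) U t) :
    HolFun U (fun y => d.coframe y (H.form y (r y) (t y))) :=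
  d.holDual_coframe hUd U _ hU subset_rfl (H.hol_form U r t hU hr ht)

theorem holFun_quad [IsManifold 𝓘(ℂ, ℂ) ω X] (hU : IsOpen U)
    (h1 : HolTwist (Model n) U fun y => (s y).1) (h2 : HolNegPow U fun y => (s y).2) :
    HolFun U (fun y => H.quad y (s y)) := by
  intro x hx
  obtain ⟨d⟩ := LocalData.nonempty (n := n) (L := L) (E := E) x
  have hWo := hU.inter d.isOpen_domain
  have hWd : U ∩ d.domain ⊆ d.trivL.baseSet := fun y hy => hy.2.2.1
  have hs1 := (h1.mono (Set.inter_subset_left (t := d.domain))).holSec_frame d hWo hWd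
  have hs2 := (h2.mono (Set.inter_subset_left (t := d.domain))).holFun_frame d hWo hWd
  have h3 : HolFun (U ∩ d.domain) (fun y => H.quad y (s y)) :=
    MDifferentiableOn.congr ((d.holFun_form H hWo hWd hs1 (d.holSec_endo H hWo hWd hs1)).add
      ((hs2.pow 2).mul ((d.holFun_charCoeff H).mono Set.inter_subset_right)))
      fun y hy => d.quad_eq H (hWd hy) (s y)
  exact (h3.mdifferentiableAt hWo ⟨hx, d.mem_domain⟩).mdifferentiableWithinAt

/-- The first-order expansion of the quadratic form at a point of `D`, for a section which at this
point lies in the kernel of `Φ`. -/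
theorem hasDerivAt_quad (hU : IsOpen U) {x : X} (hx : x ∈ U)
    (h1 : HolTwist (Model n) U fun y => (s y).1) (h2 : HolNegPow U fun y => (s y).2)
    (hxD : x ∈ H.D) (d : LocalData n L E x)
    (hker : H.endo x (d.coframe x) ((s x).1 (d.frame x)) = 0) :
    HasDerivAt (fun z => H.quad (d.chart.symm z) (s (d.chart.symm z)))
      (d.coframe x (H.form x ((s x).1 (d.frame x)) (d.higgsDeriv H ((s x).1 (d.frame x)))) +
        ((s x).2 fun _ => d.frame x) ^ 2 * deriv (d.coeffFun H (2 * n)) (d.chart x))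
      (d.chart x) := by
  have hWo := hU.inter d.isOpen_domain
  have hWd : U ∩ d.domain ⊆ d.trivL.baseSet := fun y hy => hy.2.2.1
  have hWe : U ∩ d.domain ⊆ d.trivE.baseSet := fun y hy => hy.2.2.2
  have hxW : U ∩ d.domain ∈ 𝓝 x := hWo.mem_nhds ⟨hx, d.mem_domain⟩
  have hs1 := (h1.mono (Set.inter_subset_left (t := d.domain))).holSec_frame d hWo hWd
  have hs2 := (h2.mono (Set.inter_subset_left (t := d.domain))).holFun_frame d hWo hWd
  have hleft := d.chart.left_inv d.mem_source
  set aX : X → Model n := fun y => d.trivE.linearMapAt ℂ y ((s y).1 (d.frame y)) with haX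
  set bX : X → ℂ := fun y => (s y).2 fun _ => d.frame y with hbX
  -- The symplectic part of the quadratic form becomes `B(z)(A(z)a(z))`, with `A` the Higgs matrix
  -- and `a` the section, and is differentiated by two product rules.
  set BX : X → Model n →ₗ[ℂ] ℂ := fun y =>
    d.coframe y ∘ₗ H.form y ((s y).1 (d.frame y)) ∘ₗ d.trivE.symmₗ ℂ y with hBX
  have ha : DifferentiableAt ℂ (fun z => aX (d.chart.symm z)) (d.chart x) :=
    differentiableAt_comp_chart_symm d.chart_mem d.mem_source
      (((holSec_iff d.trivE hWo hWe).1 hs1).mdifferentiableAt hxW)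
  have hb : DifferentiableAt ℂ (fun z => bX (d.chart.symm z)) (d.chart x) :=
    differentiableAt_comp_chart_symm d.chart_mem d.mem_source
      (hs2.mdifferentiableAt hWo ⟨hx, d.mem_domain⟩)
  have hB : ∀ v, DifferentiableAt ℂ (fun z => BX (d.chart.symm z) v) (d.chart x) := fun v =>
    differentiableAt_comp_chart_symm (f := fun y => BX y v) d.chart_mem d.mem_source
      ((d.holFun_form H hWo hWd hs1 (holSec_symm d.trivE hWo hWe v)).mdifferentiableAt hWo
        ⟨hx, d.mem_domain⟩)
  have hc := hasDerivAt_linearMap_apply (d.differentiableAt_higgs H d.mem_domain) ha.hasDerivAt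
  have hBc := hasDerivAt_linearMap_apply hB hc
  -- Since `A a` vanishes at `x`, the term containing the derivative of `B` drops out.
  have hc0 : d.higgs H (d.chart x) (aX (d.chart.symm (d.chart x))) = 0 := by
    rw [hleft, haX, d.higgs_linearMapAt H d.mem_domain, hker, map_zero]
  -- By skewness the term `B(A a')` drops out too, leaving only `B(A' a)`.
  have himage : ∀ u, BX x (d.higgs H (d.chart x) u) = 0 := by
    intro u
    have h3 := d.higgs_linearMapAt H d.mem_domain (d.trivE.symmₗ ℂ x u)
    rw [d.trivE.linearMapAt_symmₗ d.mem_trivE] at h3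
    have h4 := H.endo_skew x (d.coframe x) ((s x).1 (d.frame x)) (d.trivE.symmₗ ℂ x u)
    rw [hker, map_zero, LinearMap.zero_apply, zero_add] at h4
    rw [h3, hBX]
    simp only [LinearMap.comp_apply, d.trivE.symmₗ_linearMapAt d.mem_trivE]
    rw [h4, map_zero]
  have htot := hBc.add ((hb.hasDerivAt.pow 2).mul
    (d.differentiableAt_coeffFun H d.mem_domain).hasDerivAt)
  -- This removes the derivative of `w²` from the second summand.
  have ha0 : d.coeffFun H (2 * n) (d.chart x) = 0 := by
    rw [LocalData.coeffFun, hleft]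
    exact hxD _
  have hval : BX x (deriv (fun z => d.higgs H z (aX x)) (d.chart x)) =
      d.coframe x (H.form x ((s x).1 (d.frame x)) (d.higgsDeriv H ((s x).1 (d.frame x)))) := rfl
  simp only [hc0, map_zero, deriv_const, add_zero, ha0, mul_zero, zero_add] at htot
  have hb0 : ((fun z => bX (d.chart.symm z)) ^ 2) (d.chart x) = bX x ^ 2 := by
    simp only [Pi.pow_apply]
    rw [hleft]
  rw [hb0, hleft, map_add, himage, zero_add, hval] at htot
  refine htot.congr_of_eventuallyEq ?_
  filter_upwards [d.eventually_symm_mem_domain d.mem_domain] with z hz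
  have h5 := d.higgs_linearMapAt H hz.2 ((s (d.chart.symm z)).1 (d.frame (d.chart.symm z)))
  rw [d.chart.right_inv hz.1] at h5
  rw [d.quad_eq H hz.2.2.1]
  simp only [Pi.add_apply, Pi.mul_apply, Pi.pow_apply, haX, hBX, hbX, LinearMap.comp_apply,
    h5, d.trivE.symmₗ_linearMapAt hz.2.2.2]
  rfl

end Quad

/-! ### Sections of the Hecke modification -/

section Modification

variable {X : Type u} [TopologicalSpace X] [ChartedSpace ℂ X]

/-- Sections of `V` are compared only away from `D`; their values at a puncture are recovered as
limits, which needs points not to be isolated. -/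
theorem nhdsNE_neBot (x : X) : (𝓝[≠] x).NeBot := by
  set c := chartAt ℂ x
  have hx : x ∈ c.source := mem_chart_source ℂ x
  have h : Filter.Tendsto c.symm (𝓝[≠] (c x)) (𝓝[≠] x) := by
    refine tendsto_nhdsWithin_iff.2 ⟨?_, ?_⟩
    · have := (c.continuousAt_symm (c.map_source hx)).tendsto
      rw [c.left_inv hx] at this
      exact this.mono_left nhdsWithin_le_nhds
    · filter_upwards [self_mem_nhdsWithin,
        mem_nhdsWithin_of_mem_nhds (c.open_target.mem_nhds (c.map_source hx))] with z hz hzt hzx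
      exact hz (by rw [← c.right_inv hzt, hzx]; rfl)
  exact h.neBot

/-- Continuous functions which agree on a punctured neighbourhood agree at the puncture. -/
theorem eq_of_eq_on_punctured {F : Type*} [TopologicalSpace F] [T2Space F] {x : X} {W : Set X}
    (hW : IsOpen W) (hx : x ∈ W) {f g : X → F} (hf : ContinuousAt f x) (hg : ContinuousAt g x)
    (h : ∀ y ∈ W, y ≠ x → f y = g y) : f x = g x := by
  have := nhdsNE_neBot x
  refine tendsto_nhds_unique_of_eventuallyEq (hf.tendsto.mono_left nhdsWithin_le_nhds)
    (hg.tendsto.mono_left nhdsWithin_le_nhds) (l := 𝓝[≠] x) ?_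
  filter_upwards [self_mem_nhdsWithin, mem_nhdsWithin_of_mem_nhds (hW.mem_nhds hx)] with y hy hyW
  exact h y hyW hy

theorem localCoord_self (x : X) : localCoord x x = 0 := sub_self _

theorem localCoord_ne_zero {x y : X} (hy : y ∈ (chartAt ℂ x).source) (hne : y ≠ x) :
    localCoord x y ≠ 0 := fun h =>
  hne ((chartAt ℂ x).injOn hy (mem_chart_source ℂ x) (sub_eq_zero.1 h))

variable [IsManifold 𝓘(ℂ, ℂ) ω X]

theorem holFun_localCoord (x : X) : HolFun (chartAt ℂ x).source (localCoord x) := fun _y hy =>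
  (mdifferentiableAt_comp_chart (IsManifold.chart_mem_maximalAtlas x) hy
    (h := fun z => z - chartAt ℂ x x) (by fun_prop)).mdifferentiableWithinAt

theorem holFun_inv_localCoord (x : X) {U : Set X} (hU : U ⊆ (chartAt ℂ x).source) (hx : x ∉ U) :
    HolFun U (fun y => (localCoord x y)⁻¹) := fun _y hy =>
  (mdifferentiableAt_comp_chart (IsManifold.chart_mem_maximalAtlas x) (hU hy)
    (h := fun z => (z - chartAt ℂ x x)⁻¹) ((differentiableAt_id.sub_const _).inv
      (localCoord_ne_zero (hU hy) fun h => hx (h ▸ hy)))).mdifferentiableWithinAt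

variable {n : ℕ}
  {L : X → Type v} [TopologicalSpace (TotalSpace ℂ L)]
  [∀ x, AddCommGroup (L x)] [∀ x, Module ℂ (L x)] [∀ x, TopologicalSpace (L x)] [FiberBundle ℂ L]
  {E : X → Type w} [TopologicalSpace (TotalSpace (Model n) E)]
  [∀ x, AddCommGroup (E x)] [∀ x, Module ℂ (E x)] [∀ x, TopologicalSpace (E x)]
  [FiberBundle (Model n) E]
  [VectorBundle ℂ ℂ L] [VectorBundle ℂ (Model n) E]
  [ContMDiffVectorBundle ω ℂ L 𝓘(ℂ, ℂ)] [ContMDiffVectorBundle ω (Model n) E 𝓘(ℂ, ℂ)]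
  {H : SpHiggs n L E}

namespace HeckeData

/-- Local sections of the Hecke modification with prescribed residue. -/
theorem exists_isSection (hS : H.SpectralCurveSmooth) (i : HeckeData H) (x : H.D)
    (w : NegPowFibre L n x.1) {V : Set X} (hV : IsOpen V) (hxV : x.1 ∈ V) :
    ∃ (U : Set X) (s s₀ : ∀ y, SumFibre L E n y), IsOpen U ∧ x.1 ∈ U ∧ U ⊆ V ∧
      U ⊆ (chartAt ℂ x.1).source ∧ (∀ y ∈ U, y ∈ H.D → y = x.1) ∧ i.IsSection U s ∧
      HolTwist (Model n) U (fun y => (s₀ y).1) ∧ HolNegPow U (fun y => (s₀ y).2) ∧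
      (∀ y ∈ U, y ≠ x.1 → localCoord x.1 y • s y = s₀ y) ∧ s₀ x.1 = (- i.map x w, w) := by
  obtain ⟨d⟩ := LocalData.nonempty (n := n) (L := L) (E := E) x.1
  obtain ⟨U₁, hU₁, hxU₁, hUD⟩ := SpHiggs.exists_isOpen_inter_D_subset hS x.2
  set U : Set X := (U₁ ∩ V) ∩ ((chartAt ℂ x.1).source ∩ d.domain) with hUdef
  have hU : IsOpen U := (hU₁.inter hV).inter ((chartAt ℂ x.1).open_source.inter d.isOpen_domain)
  have hxU : x.1 ∈ U := ⟨⟨hxU₁, hxV⟩, mem_chart_source ℂ x.1, d.mem_domain⟩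
  have hUL : U ⊆ d.trivL.baseSet := fun y hy => hy.2.2.2.1
  have hUE : U ⊆ d.trivE.baseSet := fun y hy => hy.2.2.2.2
  have hUc : U ⊆ (chartAt ℂ x.1).source := fun y hy => hy.2.1
  -- The residue is extended as a constant vector in the trivialisations; the section is this
  -- extension divided by the coordinate.
  set e : ∀ y, E y := fun y =>
    d.trivE.symmₗ ℂ y (d.trivE.linearMapAt ℂ x.1 (- i.map x w (d.frame x.1))) with he
  set s₀ : ∀ y, SumFibre L E n y := fun y =>
    ((d.coframe y).smulRight (e y), (w fun _ => d.frame x.1) • d.negPowFrame y) with hs₀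
  have h1 : HolTwist (Model n) U (fun y => (s₀ y).1) := by
    refine d.holTwist_of_frame hUL ((holSec_symm d.trivE hU hUE
      (d.trivE.linearMapAt ℂ x.1 (- i.map x w (d.frame x.1)))).congr fun y hy => ?_)
    rw [hs₀, LinearMap.smulRight_apply, d.coframe_frame (hUL hy), one_smul]
  have h2 : HolNegPow U (fun y => (s₀ y).2) :=
    HolNegPow.smul mdifferentiableOn_const (d.holNegPow_negPowFrame hUL)
  have h3 : s₀ x.1 = (- i.map x w, w) := by
    refine Prod.ext (d.twist_ext d.mem_trivL ?_) (d.negPow_eq_smul d.mem_trivL w).symm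
    simp only [hs₀, he, LinearMap.smulRight_apply, d.coframe_frame d.mem_trivL, one_smul,
      d.trivE.symmₗ_linearMapAt d.mem_trivE, LinearMap.neg_apply]
  have h4 : ∀ y ∈ U, y ≠ x.1 → localCoord x.1 y • ((localCoord x.1 y)⁻¹ • s₀ y) = s₀ y :=
    fun y hy hne => smul_inv_smul₀ (localCoord_ne_zero (hUc hy) hne) _
  have hinv := holFun_inv_localCoord x.1 (U := U \ H.D) (Set.sdiff_subset.trans hUc)
    fun h => h.2 x.2
  refine ⟨U, fun y => (localCoord x.1 y)⁻¹ • s₀ y, s₀, hU, hxU, fun y hy => hy.1.2, hUc,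
    fun y hy => hUD y hy.1.1, ⟨HolTwist.smul hinv (h1.mono Set.sdiff_subset),
      HolNegPow.smul hinv (h2.mono Set.sdiff_subset), fun x' hx' => ?_⟩, h1, h2, h4, h3⟩
  obtain rfl : x' = x := Subtype.ext (hUD _ hx'.1.1 x'.2)
  exact ⟨U, s₀, hU, hxU, h1, h2, h4, w, h3⟩

theorem IsSection.add {i : HeckeData H} {U : Set X} {s t : ∀ y, SumFibre L E n y}
    (hs : i.IsSection U s) (ht : i.IsSection U t) : i.IsSection U (fun y => s y + t y) := by
  refine ⟨hs.1.add ht.1, hs.2.1.add ht.2.1, fun x hx => ?_⟩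
  obtain ⟨W, s₀, hW, hxW, h1, h2, h3, w, h4⟩ := hs.2.2 x hx
  obtain ⟨W', t₀, hW', hxW', h1', h2', h3', w', h4'⟩ := ht.2.2 x hx
  refine ⟨W ∩ W', fun y => s₀ y + t₀ y, hW.inter hW', ⟨hxW, hxW'⟩,
    (h1.mono Set.inter_subset_left).add (h1'.mono Set.inter_subset_right),
    (h2.mono Set.inter_subset_left).add (h2'.mono Set.inter_subset_right),
    fun y hy hne => ?_, w + w', ?_⟩
  · rw [smul_add, h3 y hy.1 hne, h3' y hy.2 hne]
  · beta_reduce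
    rw [h4, h4', map_add, neg_add]
    rfl

theorem RangeEqKer.endo_map {i : HeckeData H} (hi : i.RangeEqKer) (x : H.D)
    (d : LocalData n L E x.1) (w : NegPowFibre L n x.1) :
    H.endo x.1 (d.coframe x.1) (i.map x w (d.frame x.1)) = 0 := by
  rw [← d.mem_twistKer_iff H d.mem_trivL, ← hi x]
  exact ⟨w, rfl⟩

theorem map_frame_ne_zero (i : HeckeData H) (x : H.D) (d : LocalData n L E x.1)
    {w : NegPowFibre L n x.1} (hw : w ≠ 0) : i.map x w (d.frame x.1) ≠ 0 := fun h =>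
  hw (i.injective x (by
    rw [map_zero]
    exact d.twist_ext d.mem_trivL (by rw [h]; rfl)))

theorem negPowFrame_ne_zero {x : X} (d : LocalData n L E x) : d.negPowFrame x ≠ 0 := fun h => by
  have h1 := d.negPowFrame_frame d.mem_trivL
  rw [h] at h1
  exact zero_ne_one h1

/-- Since the kernel of `Φ_x` is a line, an inclusion suffices. -/
theorem rangeEqKer_of_endo (hS : H.SpectralCurveSmooth) {i : HeckeData H}
    (h : ∀ (x : H.D) (w : NegPowFibre L n x.1), ∃ d : LocalData n L E x.1,
      H.endo x.1 (d.coframe x.1) (i.map x w (d.frame x.1)) = 0) : i.RangeEqKer := by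
  refine fun x => le_antisymm ?_ fun t ht => ?_
  · rintro _ ⟨w, rfl⟩
    obtain ⟨d, hd⟩ := h x w
    exact (d.mem_twistKer_iff H d.mem_trivL _).2 hd
  -- The image of one non-zero element of `L_x⁻ⁿ` is non-zero by injectivity, hence spans the
  -- kernel.
  · obtain ⟨d₀⟩ := LocalData.nonempty (n := n) (L := L) (E := E) x.1
    obtain ⟨d, hd⟩ := h x (d₀.negPowFrame x.1)
    obtain ⟨c, hc⟩ := SpHiggs.exists_eq_smul_of_mem_ker hS x.2 d
      (i.map_frame_ne_zero x d (negPowFrame_ne_zero d₀)) hd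
      ((d.mem_twistKer_iff H d.mem_trivL t).1 ht)
    refine ⟨c • d₀.negPowFrame x.1, d.twist_ext d.mem_trivL ?_⟩
    rw [map_smul, LinearMap.smul_apply, hc]

/-- A section with residue `(-i_x w, w)` is sent to one with residue `(-Φ_x i_x w, 0)`, and an
element of `Γ_x` with second component zero is zero. -/
theorem rangeEqKer_of_phiExtends (hS : H.SpectralCurveSmooth) {i : HeckeData H}
    (hi : i.PhiExtends) : i.RangeEqKer := by
  refine rangeEqKer_of_endo hS fun x w => ?_
  obtain ⟨d⟩ := LocalData.nonempty (n := n) (L := L) (E := E) x.1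
  refine ⟨d, ?_⟩
  obtain ⟨U, s, s₀, hU, hxU, hUd, -, -, hsec, h1, h2, h3, h4⟩ :=
    i.exists_isSection hS x w d.isOpen_domain d.mem_domain
  have hUL : U ⊆ d.trivL.baseSet := fun y hy => (hUd hy).2.1
  obtain ⟨W, t₀, hW, hxW, h1', h2', h3', w', h4'⟩ :=
    (hi U d.coframe s hU (d.holDual_coframe hUL) hsec).2.2 x hxU
  have hVo : IsOpen (U ∩ W) := hU.inter hW
  have hxV : x.1 ∈ U ∩ W := ⟨hxU, hxW⟩
  have hVL : U ∩ W ⊆ d.trivL.baseSet := fun y hy => hUL hy.1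
  have hVE : U ∩ W ⊆ d.trivE.baseSet := fun y hy => (hUd hy.1).2.2
  -- Both sides are the coordinate times `φ(s)`. Their components extend continuously over `x`, so
  -- the identity passes to the puncture.
  have heq : ∀ y ∈ U ∩ W, y ≠ x.1 → t₀ y = H.phi y (d.coframe y) (s₀ y) := by
    intro y hy hne
    rw [← h3' y hy.2 hne, ← h3 y hy.1 hne]
    refine Prod.ext ?_ (smul_zero _)
    exact (LinearMap.comp_smul _ _ _).symm
  have hw' : w' = 0 := by
    refine d.negPow_ext d.mem_trivL ?_
    have := eq_of_eq_on_punctured (F := ℂ) hVo hxV (f := fun y => (t₀ y).2 fun _ => d.frame y)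
      (g := fun _ => 0)
      ((((h2'.mono Set.inter_subset_right).holFun_frame d hVo hVL).mdifferentiableAt hVo
        hxV).continuousAt) continuousAt_const
      (fun y hy hne => by rw [heq y hy hne]; rfl)
    rw [h4'] at this
    exact this
  have hsec1 := (h1'.mono (Set.inter_subset_right (s := U))).holSec_frame d hVo hVL
  have hsec2 := d.holSec_endo H hVo hVL
    ((h1.mono (Set.inter_subset_left (t := W))).holSec_frame d hVo hVL)
  rw [holSec_iff d.trivE hVo hVE] at hsec1 hsec2
  have := eq_of_eq_on_punctured hVo hxV
    (hsec1.mdifferentiableAt (hVo.mem_nhds hxV)).continuousAt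
    (hsec2.mdifferentiableAt (hVo.mem_nhds hxV)).continuousAt
    (fun y hy hne => by rw [heq y hy hne]; rfl)
  rw [h4, h4', hw'] at this
  have h5 := congrArg (d.trivE.symmₗ ℂ x.1) this
  rw [d.trivE.symmₗ_linearMapAt d.mem_trivE, d.trivE.symmₗ_linearMapAt d.mem_trivE] at h5
  simpa using h5.symm

/-- `Φ_x` kills the residue, so `φ(s)` has residue zero, the element of `Γ_x` given by `w = 0`. -/
theorem phiExtends_of_rangeEqKer {i : HeckeData H} (hi : i.RangeEqKer) : i.PhiExtends := by
  intro U ξ s hU hξ hs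
  have hphi : ∀ (V : Set X) (t : ∀ y, SumFibre L E n y), V ⊆ U →
      HolTwist (Model n) V (fun y => (t y).1) →
      HolTwist (Model n) V (fun y => (H.phi y (ξ y) (t y)).1) :=
    fun V t hVU ht W l hW hWV hl =>
      H.hol_Φ W ξ _ hW (hξ.mono (hWV.trans hVU)) (ht W l hW hWV hl)
  refine ⟨hphi _ _ Set.sdiff_subset hs.1, HolNegPow.zero, fun x hx => ?_⟩
  obtain ⟨W, s₀, hW, hxW, h1, h2, h3, w, h4⟩ := hs.2.2 x hx
  refine ⟨U ∩ W, fun y => H.phi y (ξ y) (s₀ y), hU.inter hW, ⟨hx, hxW⟩,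
    hphi _ _ Set.inter_subset_left (h1.mono Set.inter_subset_right), HolNegPow.zero,
    fun y hy hne => ?_, 0, ?_⟩
  · beta_reduce
    rw [← h3 y hy.2 hne]
    refine Prod.ext ?_ (smul_zero _)
    exact (LinearMap.comp_smul _ _ _).symm
  · obtain ⟨d⟩ := LocalData.nonempty (n := n) (L := L) (E := E) x.1
    beta_reduce
    rw [h4, map_zero]
    refine Prod.ext (d.twist_ext d.mem_trivL ?_) rfl
    have h5 := hi.endo_map x d w
    rw [← d.smul_coframe d.mem_trivL (ξ x.1)]
    simp only [SpHiggs.phi, H.endo_smul, LinearMap.comp_apply, LinearMap.neg_apply, map_neg,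
      LinearMap.smul_apply, h5, smul_zero, neg_zero, LinearMap.zero_apply]

end HeckeData

end Modification

/-! ### Extension of the quadratic form and the choice of Hecke data -/

/-- Gluing of a function on the complement of a closed discrete set with local extensions. -/
theorem exists_holFun_extension {X : Type*} [TopologicalSpace X] [ChartedSpace ℂ X] {U D : Set X}
    (hU : IsOpen U) (hD : IsClosed D) {F : X → ℂ} (hF : HolFun (U \ D) F)
    (hloc : ∀ x, x ∈ D ∧ x ∈ U → ∃ (W : Set X) (f : X → ℂ), IsOpen W ∧ x ∈ W ∧
      (∀ y ∈ W, y ∈ D → y = x) ∧ HolFun W f ∧ ∀ y ∈ W, y ≠ x → f y = F y) :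
    ∃ f : X → ℂ, HolFun U f ∧ ∀ y ∈ U \ D, f y = F y := by
  classical
  choose W f hW hxW hWD hf hfF using hloc
  refine ⟨fun y => if h : y ∈ D ∧ y ∈ U then f y h y else F y, fun y hy => ?_, fun y hy => ?_⟩
  · refine MDifferentiableAt.mdifferentiableWithinAt ?_
    by_cases hyD : y ∈ D
    · have h : y ∈ D ∧ y ∈ U := ⟨hyD, hy⟩
      refine ((hf y h).mdifferentiableAt (hW y h) (hxW y h)).congr_of_eventuallyEq ?_
      filter_upwards [(hW y h).mem_nhds (hxW y h)] with t ht
      by_cases htD : t ∈ D ∧ t ∈ U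
      · obtain rfl := hWD y h t ht htD.1
        rw [dif_pos htD]
      · rw [dif_neg htD]
        exact (hfF y h t ht fun hty => htD (hty ▸ h)).symm
    · have hopen : IsOpen (U \ D) := hU.sdiff hD
      refine (hF.mdifferentiableAt hopen ⟨hy, hyD⟩).congr_of_eventuallyEq ?_
      filter_upwards [hopen.mem_nhds ⟨hy, hyD⟩] with t ht
      rw [dif_neg fun h => ht.2 h.1]
  · exact dif_neg fun h => hy.2 h.1

section Modification

variable {X : Type u} [TopologicalSpace X] [ChartedSpace ℂ X] [IsManifold 𝓘(ℂ, ℂ) ω X]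
  {n : ℕ}
  {L : X → Type v} [TopologicalSpace (TotalSpace ℂ L)]
  [∀ x, AddCommGroup (L x)] [∀ x, Module ℂ (L x)] [∀ x, TopologicalSpace (L x)] [FiberBundle ℂ L]
  {E : X → Type w} [TopologicalSpace (TotalSpace (Model n) E)]
  [∀ x, AddCommGroup (E x)] [∀ x, Module ℂ (E x)] [∀ x, TopologicalSpace (E x)]
  [FiberBundle (Model n) E]
  [VectorBundle ℂ ℂ L] [VectorBundle ℂ (Model n) E]
  [ContMDiffVectorBundle ω ℂ L 𝓘(ℂ, ℂ)] [ContMDiffVectorBundle ω (Model n) E 𝓘(ℂ, ℂ)]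
  {H : SpHiggs n L E}

namespace HeckeData

/-- Lowers the possible pole of `Q(s, s)` from order two to order one, so only a first-order
coefficient can obstruct extension. -/
theorem RangeEqKer.quad_residue {i : HeckeData H} (hi : i.RangeEqKer) (x : H.D)
    (w : NegPowFibre L n x.1) : H.quad x.1 (- i.map x w, w) = 0 := by
  obtain ⟨d⟩ := LocalData.nonempty (n := n) (L := L) (E := E) x.1
  rw [d.quad_eq H d.mem_trivL, (d.mem_D_iff H d.mem_trivL).1 x.2]
  simp only [LinearMap.neg_apply, map_neg, hi.endo_map x d w, map_zero, mul_zero, add_zero,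
    neg_zero]

/-- The derivative of the quadratic form along a section which is a residue at `x ∈ D`. -/
theorem RangeEqKer.hasDerivAt_quad {i : HeckeData H} (hi : i.RangeEqKer) (x : H.D)
    (d : LocalData n L E x.1) {w : NegPowFibre L n x.1} {U : Set X} (hU : IsOpen U)
    (hx : x.1 ∈ U) {s : ∀ y, SumFibre L E n y}
    (h1 : HolTwist (Model n) U fun y => (s y).1) (h2 : HolNegPow U fun y => (s y).2)
    (h3 : s x.1 = (- i.map x w, w)) :
    HasDerivAt (fun z => H.quad (d.chart.symm z) (s (d.chart.symm z)))
      (d.coframe x.1 (H.form x.1 (i.map x w (d.frame x.1))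
        (d.higgsDeriv H (i.map x w (d.frame x.1)))) +
        (w fun _ => d.frame x.1) ^ 2 * deriv (d.coeffFun H (2 * n)) (d.chart x.1))
      (d.chart x.1) := by
  have hk := hi.endo_map x d w
  have h := HeckeHiggs.hasDerivAt_quad (H := H) hU hx h1 h2 x.2 d
    (by rw [h3, LinearMap.neg_apply, map_neg, hk, neg_zero])
  have hneg : d.higgsDeriv H ((- i.map x w) (d.frame x.1)) =
      - d.higgsDeriv H (i.map x w (d.frame x.1)) := by
    rw [LinearMap.neg_apply, ← neg_one_smul ℂ, d.higgsDeriv_smul, neg_one_smul]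
  rw [h3, hneg] at h
  simpa only [LinearMap.neg_apply, map_neg, neg_neg] using h

/-- If `Q(s, s)` extends to `f`, then `Q(s₀, s₀) = z² f` has zero derivative at `x`; the other
computation of this derivative is the defect in the scale condition. -/
theorem scaleCondition_of_QExtends (hS : H.SpectralCurveSmooth) {i : HeckeData H}
    (hi : i.RangeEqKer) (hQ : i.QExtends) (x : H.D) (d : LocalData n L E x.1) :
    i.ScaleCondition x d := by
  intro w
  obtain ⟨U, s, s₀, hU, hxU, hUd, hUc, hUD, hsec, h1, h2, h3, h4⟩ :=
    i.exists_isSection hS x w d.isOpen_domain d.mem_domain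
  obtain ⟨f, hf, hfQ⟩ := hQ U s s hU hsec hsec
  have hG : ∀ y ∈ U, H.quad y (s₀ y) = localCoord x.1 y ^ 2 * f y := by
    intro y hy
    by_cases hne : y = x.1
    · rw [hne, h4, hi.quad_residue, localCoord_self]
      simp
    · rw [← h3 y hy hne, H.quad_smul, hfQ y ⟨hy, fun hyD => hne (hUD y hy hyD)⟩, H.Q_self]
  have hd1 := hi.hasDerivAt_quad x d hU hxU h1 h2 h4
  have hκ := (differentiableAt_comp_chart_symm d.chart_mem d.mem_source
    ((holFun_localCoord x.1).mdifferentiableAt (chartAt ℂ x.1).open_source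
      (mem_chart_source ℂ x.1))).hasDerivAt
  have hfd := (differentiableAt_comp_chart_symm d.chart_mem d.mem_source
    (hf.mdifferentiableAt hU hxU)).hasDerivAt
  -- The coordinate in the pole condition need not be that of `d`; its square has zero derivative at
  -- `x` in either.
  have hd2 := (hκ.fun_pow 2).fun_mul hfd
  rw [d.chart.left_inv d.mem_source, localCoord_self] at hd2
  have heq : (fun z => H.quad (d.chart.symm z) (s₀ (d.chart.symm z))) =ᶠ[𝓝 (d.chart x.1)]
      fun z => localCoord x.1 (d.chart.symm z) ^ 2 * f (d.chart.symm z) := by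
    have : d.chart.symm ⁻¹' U ∈ 𝓝 (d.chart x.1) :=
      (d.chart.continuousAt_symm (d.chart.map_source d.mem_source)).preimage_mem_nhds
        (by rw [d.chart.left_inv d.mem_source]; exact hU.mem_nhds hxU)
    filter_upwards [this] with z hz
    exact hG _ hz
  have h5 := hd1.unique (hd2.congr_of_eventuallyEq heq)
  simp only [ne_eq, OfNat.ofNat_ne_zero, not_false_eq_true, zero_pow, zero_mul, add_zero,
    Nat.cast_ofNat, Nat.add_one_sub_one, pow_one, mul_zero] at h5
  linear_combination h5

/-- If the scale condition holds at `x ∈ D`, then the quadratic form extends over `x`. -/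
theorem ScaleCondition.exists_extension {i : HeckeData H} (hi : i.RangeEqKer) {x : H.D}
    {d : LocalData n L E x.1} (hd : i.ScaleCondition x d) {s : ∀ y, SumFibre L E n y}
    (hs : i.PoleAt x s) :
    ∃ (W : Set X) (f : X → ℂ), IsOpen W ∧ x.1 ∈ W ∧ HolFun W f ∧
      ∀ y ∈ W, y ≠ x.1 → f y = H.quad y (s y) := by
  obtain ⟨W, s₀, hW, hxW, h1, h2, h3, w, h4⟩ := hs
  have hG : HolFun W fun y => H.quad y (s₀ y) := holFun_quad hW h1 h2
  have hc := IsManifold.chart_mem_maximalAtlas (I := 𝓘(ℂ, ℂ)) (n := ω) x.1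
  have hxc := mem_chart_source ℂ x.1
  set c := chartAt ℂ x.1
  have hT : IsOpen (c.target ∩ c.symm ⁻¹' W) := c.isOpen_inter_preimage_symm hW
  have hxT : c x.1 ∈ c.target ∩ c.symm ⁻¹' W :=
    ⟨c.map_source hxc, by rw [Set.mem_preimage, c.left_inv hxc]; exact hxW⟩
  -- The scale condition is given in the chart of `d`, while the pole is measured in the preferred
  -- chart; vanishing of a derivative transfers between them.
  have hderiv : deriv (fun z => H.quad (c.symm z) (s₀ (c.symm z))) (c x.1) = 0 := by
    refine deriv_comp_chart_symm_eq_zero (f := fun y => H.quad y (s₀ y)) d.chart_mem hc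
      d.mem_source hxc (hG.mdifferentiableAt hW hxW) ?_
    rw [(hi.hasDerivAt_quad x d hW hxW h1 h2 h4).deriv, hd w]
    ring
  obtain ⟨h, hh, hgh⟩ := exists_eq_sq_mul (hT.mem_nhds hxT)
    (g := fun z => H.quad (c.symm z) (s₀ (c.symm z))) (fun z hz => by
      have h5 := differentiableAt_comp_chart_symm (f := fun y => H.quad y (s₀ y)) hc
        (c.map_target hz.1) (hG.mdifferentiableAt hW hz.2)
      rw [c.right_inv hz.1] at h5
      exact h5.differentiableWithinAt)
    (by rw [c.left_inv hxc, h4, hi.quad_residue]) hderiv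
  refine ⟨W ∩ c.source, fun y => h (c y), hW.inter c.open_source, ⟨hxW, hxc⟩, fun y hy => ?_,
    fun y hy hne => ?_⟩
  · have hyT : c y ∈ c.target ∩ c.symm ⁻¹' W :=
      ⟨c.map_source hy.2, by rw [Set.mem_preimage, c.left_inv hy.2]; exact hy.1⟩
    exact (mdifferentiableAt_comp_chart hc hy.2
      (hh.differentiableAt (hT.mem_nhds hyT))).mdifferentiableWithinAt
  · have h6 := hgh (c y)
    rw [c.left_inv hy.2, ← h3 y hy.1 hne, H.quad_smul] at h6
    exact (mul_left_cancel₀ (pow_ne_zero 2 (localCoord_ne_zero hy.2 hne)) h6).symm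

/-- Polarisation expresses `Q(s, t)` through the diagonal values at `s + t`, `s` and `t`, all
sections of `V`. Each extends near a point of `D`, and discreteness of `D` allows gluing. -/
theorem QExtends_of_scaleCondition (hS : H.SpectralCurveSmooth) {i : HeckeData H}
    (hi : i.RangeEqKer) (d : ∀ x : H.D, LocalData n L E x.1)
    (hd : ∀ x, i.ScaleCondition x (d x)) : i.QExtends := by
  intro U s t hU hs ht
  have hDc := SpHiggs.isClosed_D H
  have hopen : IsOpen (U \ H.D) := hU.sdiff hDc
  have hst := hs.add ht
  refine exists_holFun_extension hU hDc (F := fun y => H.Q y (s y) (t y)) ?_ ?_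
  · have h1 : HolFun (U \ H.D) (fun y => H.quad y (s y + t y)) := holFun_quad hopen hst.1 hst.2.1
    have h2 : HolFun (U \ H.D) (fun y => H.quad y (s y)) := holFun_quad hopen hs.1 hs.2.1
    have h3 : HolFun (U \ H.D) (fun y => H.quad y (t y)) := holFun_quad hopen ht.1 ht.2.1
    exact (((MDifferentiableOn.sub h1 h2).sub h3).mul
      (mdifferentiableOn_const (c := (2 : ℂ)⁻¹))).congr fun y _ => rfl
  · rintro x ⟨hxD, hxU⟩
    obtain ⟨U₁, hU₁, hxU₁, hUD⟩ := SpHiggs.exists_isOpen_inter_D_subset hS hxD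
    obtain ⟨W₁, f₁, hW₁, hx₁, hf₁, h₁⟩ := (hd ⟨x, hxD⟩).exists_extension hi (hst.2.2 ⟨x, hxD⟩ hxU)
    obtain ⟨W₂, f₂, hW₂, hx₂, hf₂, h₂⟩ := (hd ⟨x, hxD⟩).exists_extension hi (hs.2.2 ⟨x, hxD⟩ hxU)
    obtain ⟨W₃, f₃, hW₃, hx₃, hf₃, h₃⟩ := (hd ⟨x, hxD⟩).exists_extension hi (ht.2.2 ⟨x, hxD⟩ hxU)
    refine ⟨U₁ ∩ (W₁ ∩ (W₂ ∩ W₃)), fun y => (f₁ y - f₂ y - f₃ y) * 2⁻¹,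
      hU₁.inter (hW₁.inter (hW₂.inter hW₃)), ⟨hxU₁, hx₁, hx₂, hx₃⟩, fun y hy => hUD y hy.1, ?_,
      fun y hy hne => ?_⟩
    · exact (((MDifferentiableOn.sub (hf₁.mono fun y hy => hy.2.1)
        (hf₂.mono fun y hy => hy.2.2.1)).sub (hf₃.mono fun y hy => hy.2.2.2)).mul
        (mdifferentiableOn_const (c := (2 : ℂ)⁻¹)))
    · beta_reduce
      rw [h₁ y hy.2.1 hne, h₂ y hy.2.2.1 hne, h₃ y hy.2.2.2 hne, SpHiggs.Q, div_eq_mul_inv]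

theorem map_eq_smul {i i' : HeckeData H} {x : H.D} (d : LocalData n L E x.1) {μ : ℂ}
    (h : i'.map x (d.negPowFrame x.1) (d.frame x.1) =
      μ • i.map x (d.negPowFrame x.1) (d.frame x.1)) : i'.map x = μ • i.map x := by
  refine LinearMap.ext fun w => d.twist_ext d.mem_trivL ?_
  rw [d.negPow_eq_smul d.mem_trivL w]
  simp only [map_smul, LinearMap.smul_apply, h]

/-- Hecke data with range the kernel of `Φ` satisfying the scale condition are unique up to
sign. -/
theorem map_eq_or_eq_neg (hS : H.SpectralCurveSmooth) {i i' : HeckeData H} (hi : i.RangeEqKer)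
    (hi' : i'.RangeEqKer) {x : H.D} {d : LocalData n L E x.1} (hd : i.ScaleCondition x d)
    (hd' : i'.ScaleCondition x d) : i'.map x = i.map x ∨ i'.map x = - i.map x := by
  have h0 := i.map_frame_ne_zero x d (negPowFrame_ne_zero d)
  have hk := hi.endo_map x d (d.negPowFrame x.1)
  obtain ⟨μ, hμ⟩ := SpHiggs.exists_eq_smul_of_mem_ker hS x.2 d h0 hk
    (hi'.endo_map x d (d.negPowFrame x.1))
  have hne := SpHiggs.form_higgsDeriv_ne_zero hS x.2 d h0 hk
  have h1 := hd (d.negPowFrame x.1)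
  have h2 := hd' (d.negPowFrame x.1)
  rw [hμ, d.higgsDeriv_smul, ← h1] at h2
  simp only [map_smul, LinearMap.smul_apply, smul_eq_mul] at h2
  -- Both scale conditions prescribe the same value of a form quadratic in `μ`, whose coefficient
  -- `ω(e, Φ'_x e)` is non-zero.
  have h3 : μ ^ 2 = 1 := mul_right_cancel₀ hne (by linear_combination h2)
  rcases eq_or_eq_neg_of_sq_eq_sq μ 1 (by rw [h3, one_pow]) with rfl | rfl
  · left
    rw [map_eq_smul d hμ, one_smul]
  · right
    refine (map_eq_smul d hμ).trans (LinearMap.ext fun w => ?_)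
    rw [LinearMap.smul_apply, LinearMap.neg_apply, neg_one_smul]

theorem rangeEqKer_of_map_eq_or_eq_neg {i i' : HeckeData H} (hi : i.RangeEqKer)
    (h : ∀ x, i'.map x = i.map x ∨ i'.map x = - i.map x) : i'.RangeEqKer := by
  intro x
  rw [← hi x]
  rcases h x with h | h
  · rw [h]
  · rw [h, LinearMap.range_neg]

theorem ScaleCondition.of_map_eq_or_eq_neg {i i' : HeckeData H} {x : H.D}
    {d : LocalData n L E x.1} (hd : i.ScaleCondition x d)
    (h : i'.map x = i.map x ∨ i'.map x = - i.map x) : i'.ScaleCondition x d := by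
  intro w
  rw [← hd w]
  rcases h with h | h
  · rw [h]
  · rw [h, LinearMap.neg_apply, LinearMap.neg_apply, ← neg_one_smul ℂ, d.higgsDeriv_smul]
    simp

variable (H) in
/-- Existence of Hecke data with range the kernel of `Φ` satisfying the scale condition. -/
theorem exists_scaleCondition (hS : H.SpectralCurveSmooth)
    (d : ∀ x : H.D, LocalData n L E x.1) :
    ∃ i : HeckeData H, i.RangeEqKer ∧ ∀ x, i.ScaleCondition x (d x) := by
  choose e he0 he using fun x : H.D => H.exists_ker x.2 ((d x).coframe x.1)
  -- The scale condition for the map `w ↦ c w e`, with everything written in frames; it is solved by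
  -- a complex square root.
  have hc : ∀ x : H.D, ∃ c : ℂ, c ^ 2 * (d x).coframe x.1 (H.form x.1 (e x)
      ((d x).higgsDeriv H (e x))) = - deriv ((d x).coeffFun H (2 * n)) ((d x).chart x.1) := by
    intro x
    have hne := SpHiggs.form_higgsDeriv_ne_zero hS x.2 (d x) (he0 x) (he x)
    obtain ⟨c, hc⟩ := IsAlgClosed.exists_pow_nat_eq
      (- deriv ((d x).coeffFun H (2 * n)) ((d x).chart x.1) / (d x).coframe x.1 (H.form x.1 (e x)
        ((d x).higgsDeriv H (e x)))) two_pos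
    exact ⟨c, by rw [hc, div_mul_cancel₀ _ hne]⟩
  choose c hc using hc
  -- Simplicity of the zero of `a₂ₙ` is used again, now to make the Hecke map injective.
  have hc0 : ∀ x, c x ≠ 0 := by
    intro x h0
    have h1 := hc x
    rw [h0, zero_pow two_ne_zero, zero_mul, eq_comm, neg_eq_zero] at h1
    exact H.deriv_coeffFun_ne_zero hS x.2 (d x) h1
  let m : ∀ x : H.D, NegPowFibre L n x.1 →ₗ[ℂ] TwistFibre L E x.1 := fun x =>
    { toFun := fun w => (c x * w fun _ => (d x).frame x.1) • ((d x).coframe x.1).smulRight (e x)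
      map_add' := fun w w' => by rw [add_apply, mul_add, add_smul]
      map_smul' := fun k w => by
        rw [RingHom.id_apply, smul_smul]
        congr 1
        simp only [smul_apply, smul_eq_mul]
        ring }
  have hm : ∀ x w, m x w ((d x).frame x.1) = (c x * w fun _ => (d x).frame x.1) • e x := by
    intro x w
    change (c x * w fun _ => (d x).frame x.1) •
      ((d x).coframe x.1 ((d x).frame x.1) • e x) = _
    rw [(d x).coframe_frame (d x).mem_trivL, one_smul]
  refine ⟨⟨m, fun x => ?_⟩, rangeEqKer_of_endo hS fun x w => ⟨d x, ?_⟩, fun x w => ?_⟩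
  · rw [← LinearMap.ker_eq_bot, LinearMap.ker_eq_bot']
    intro w hw
    have h1 := hm x w
    rw [hw, LinearMap.zero_apply, eq_comm, smul_eq_zero_iff_left (he0 x),
      mul_eq_zero_iff_left (hc0 x)] at h1
    exact (d x).negPow_ext (d x).mem_trivL h1
  · change H.endo x.1 _ (m x w ((d x).frame x.1)) = 0
    rw [hm, map_smul, he, smul_zero]
  · change (d x).coframe x.1 (H.form x.1 (m x w ((d x).frame x.1))
      ((d x).higgsDeriv H (m x w ((d x).frame x.1)))) = _
    rw [hm, (d x).higgsDeriv_smul]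
    simp only [map_smul, LinearMap.smul_apply, smul_eq_mul]
    linear_combination (w fun _ => (d x).frame x.1) ^ 2 * hc x

end HeckeData

end Modification

end

end HeckeHiggs

/-! ### The main theorem -/

theorem mainTheorem4
    {X : Type*} [TopologicalSpace X] [T2Space X] [CompactSpace X] [ConnectedSpace X]
    [ChartedSpace ℂ X] [IsManifold 𝓘(ℂ, ℂ) ω X]
    (n : ℕ) (hn : 1 ≤ n)
    (L : X → Type*) [TopologicalSpace (TotalSpace ℂ L)]
    [∀ x, AddCommGroup (L x)] [∀ x, Module ℂ (L x)] [∀ x, TopologicalSpace (L x)]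
    [FiberBundle ℂ L] [VectorBundle ℂ ℂ L] [ContMDiffVectorBundle ω ℂ L 𝓘(ℂ, ℂ)]
    (E : X → Type*) [TopologicalSpace (TotalSpace (HeckeHiggs.Model n) E)]
    [∀ x, AddCommGroup (E x)] [∀ x, Module ℂ (E x)] [∀ x, TopologicalSpace (E x)]
    [FiberBundle (HeckeHiggs.Model n) E] [VectorBundle ℂ (HeckeHiggs.Model n) E]
    [ContMDiffVectorBundle ω (HeckeHiggs.Model n) E 𝓘(ℂ, ℂ)]
    (H : HeckeHiggs.SpHiggs n L E)
    (hS : H.SpectralCurveSmooth)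
    (hD : Disjoint (H.zeros (2 * n - 2)) H.D) :
    (∀ i : HeckeHiggs.HeckeData H, i.PhiExtends ↔ i.RangeEqKer) ∧
    (∀ i : HeckeHiggs.HeckeData H, i.RangeEqKer →
      ∀ d : ∀ x : H.D, HeckeHiggs.LocalData n L E x.1,
        (i.QExtends ↔ ∀ x : H.D, i.ScaleCondition x (d x))) ∧
    (∃ i : HeckeHiggs.HeckeData H,
      i.RangeEqKer ∧
      (∀ (x : H.D) (d : HeckeHiggs.LocalData n L E x.1), i.ScaleCondition x d) ∧
      i.PhiExtends ∧ i.QExtends ∧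
      ∀ (d : ∀ x : H.D, HeckeHiggs.LocalData n L E x.1) (i' : HeckeHiggs.HeckeData H),
        (i'.RangeEqKer ∧ ∀ x : H.D, i'.ScaleCondition x (d x)) ↔
          ∀ x : H.D, i'.map x = i.map x ∨ i'.map x = - i.map x) := by
  refine ⟨fun i => ⟨HeckeHiggs.HeckeData.rangeEqKer_of_phiExtends hS,
    HeckeHiggs.HeckeData.phiExtends_of_rangeEqKer⟩, fun i hi d =>
    ⟨fun hQ x => HeckeHiggs.HeckeData.scaleCondition_of_QExtends hS hi hQ x (d x),
      HeckeHiggs.HeckeData.QExtends_of_scaleCondition hS hi d⟩, ?_⟩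
  obtain ⟨i, hi, hi'⟩ := HeckeHiggs.HeckeData.exists_scaleCondition H hS
    fun x => (HeckeHiggs.LocalData.nonempty x.1).some
  -- The scale condition is arranged for one choice of local data; passing through the
  -- coordinate-free extension of `Q` and back yields it for every choice.
  have hQ := HeckeHiggs.HeckeData.QExtends_of_scaleCondition hS hi _ hi'
  have hd := HeckeHiggs.HeckeData.scaleCondition_of_QExtends hS hi hQ
  refine ⟨i, hi, hd, HeckeHiggs.HeckeData.phiExtends_of_rangeEqKer hi, hQ,
    fun d i' => ⟨fun h x => ?_, fun h => ⟨?_, fun x => ?_⟩⟩⟩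
  · exact HeckeHiggs.HeckeData.map_eq_or_eq_neg hS hi h.1 (hd x (d x)) (h.2 x)
  · exact HeckeHiggs.HeckeData.rangeEqKer_of_map_eq_or_eq_neg hi h
  · exact (hd x (d x)).of_map_eq_or_eq_neg (h x)
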